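/- **Setting.** Let $\mathbb D\subseteq\mathbb R^n$ ($n\ge 1$) be open and let $\mu$ be a Borel probability measure on $\mathbb D$. Let $\mathbb B_{x,\epsilon}$ be the open Euclidean ball of radius $\epsilon$ about $x$, let $\mathbb D_\epsilon=\{x\in\mathbb D:\mathbb B_{x,\epsilon}\subseteq\mathbb D\}$, and let $\mu_{x,\epsilon}$ be $\mu$ conditioned on $\mathbb B_{x,\epsilon}$ (whenever $\mu(\mathbb B_{x,\epsilon})>0$). Put $P_{x,y}=(y-x)(y-x)^*/\|y-x\|_2^2$. *Near-isotropy.* Fix $C_0>0$. Assume there are $\epsilon_\mu\in(0,\infty]$ and $K_\mu>0$ such that for all $0<\epsilon\le\epsilon_\mu$ (finite), $x\in\mathbb D_\epsilon$, $\beta\ge0$ and $v\in\mathbb R^n$, $$\Pr_{y\sim\mu_{x,\epsilon}}\big[\|P_{x,y}v\|_2^2>\beta\|v\|_2^2/n\big]\le C_0e^{-K_\mu\beta}.$$ *Function.* Let $f:\mathbb D\to\mathbb R$ be twice differentiable with $L_f=\sup_{\mathbb D}\|\nabla f\|_2<\infty$ and $H_f=\sup_{\mathbb D}\|\nabla^2f\|_2<\infty$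 (spectral norm). *Samples.* Let $X=(x_1,\dots,x_N)$, $N\ge1$, be fixed points of $\mathbb D$. Let $\epsilon_X$ be the supremum of all $\epsilon'$ such that $X\subset\mathbb D_{\epsilon'}$ and different points of $X$ are at distance at least $2\epsilon'$. Fix $0<\epsilon\le\min(\epsilon_\mu,\epsilon_X)$ and put $\mathbb B_{X,\epsilon}=\bigcup_{x\in X}\mathbb B_{x,\epsilon}$. Let $Y=Y_{X,\epsilon}$ consist of $N_{X,\epsilon}\ge N$ independent points drawn from $\mu$ conditioned on $\mathbb B_{X,\epsilon}$. Let $Y_{x,\epsilon}$ be those of them in $\mathbb B_{x,\epsilon}$ and $N_{x,\epsilon}$ their number. Let $1\le m\le N_{X,\epsilon}$ be an integer (written $N_{X,\min,\epsilon}$ below), and set $$\rho=\rho_{\mu,X,\epsilon}=N\min_{x\in X}\frac{\mu(\mathbb B_{x,\epsilon})}{\mu(\mathbb B_{X,\epsilon})},\qquad \dot\nabla_x=\frac n{N_{x,\epsilon}}\sum_{y\in Y_{x,\epsilon}}\frac{f(y)-f(x)}{\|y-x\|_2}\,\frac{y-x}{\|y-x\|_2}.$$ The estimator and the empirical second-moment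 matrix are $$\ddot\Sigma=\frac1N\Big(1+\frac{1-\frac2n}{1+\frac2n}\,m^{-1}\Big)^{-1}\sum_{x\in X:\,N_{x,\epsilon}\ge m}\Big(\dot\nabla_x\dot\nabla_x^*-\frac{\|\dot\nabla_x\|_2^2}{(1+\frac2n)m+n+1-\frac2n}I_n\Big),\qquad \dot\Sigma_X=\frac1N\sum_{x\in X}\nabla f(x)\nabla f(x)^*.$$ *Bias terms.* With suprema over those $x\in\mathbb D_\epsilon$ for which $\mu_{x,\epsilon}$ is defined and expectations over $y\sim\mu_{x,\epsilon}$, let $$B'=n\sup_x\big\|\mathbb E[P_{x,y}]-\tfrac1nI_n\big\|_2,$$ $$B''=n^2\sup_x\Big\|\mathbb E[P_{x,y}\nabla f(x)\nabla f(x)^*P_{x,y}]-\frac{2\nabla f(x)\nabla f(x)^*+\|\nabla f(x)\|_2^2I_n}{n(n+2)}\Big\|_F,$$ $$B_{\mu,\epsilon}=\frac{2B''}{m}+4B'(B'+1)L_f^2+\frac{2L_f^2(1+\sqrt n)}{m},$$ $$R=n^2L_f^2N^{-10}+\epsilon^2H_f^2n^2+\epsilon L_fH_fn^{3/2}\max(K_\mu^{-1/2},1)\log^{1/2}N_{X,\epsilon}.$$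 **Theorem (Bias).** There is a universal constant $c>0$, and for every $C_0>0$ there is a constant $C>0$ depending only on $C_0$, such that the following hold in the setting above whenever $N_{X,\epsilon}\ge n^{1/20}$. 1. If $\rho>0$, $N_{X,\epsilon}\ge 2N_{X,\min,\epsilon}N/\rho$ and $N_{X,\min,\epsilon}\ge c\log^2N$, then $\ddot\Sigma$ is integrable and $$\big\|\mathbb E_{Y|X}[\ddot\Sigma]-\dot\Sigma_X\big\|_F\le C\,(B_{\mu,\epsilon}+R).$$ 2. Suppose $\mathbb D$ is bounded, $\mu$ is the uniform probability measure on $\mathbb D$, and $N_{X,\min,\epsilon}=N_{X,\epsilon}/N$. Then, conditioned on the event that $N_{x,\epsilon}=N_{X,\epsilon}/N$ for all $x\in X$ (provided it has positive probability), $\ddot\Sigma$ is integrable and the bound holds with $B_{\mu,\epsilon}$ replaced by $0$: $$\big\|\mathbb E_{Y|X}[\ddot\Sigma\mid N_{x,\epsilon}=N_{X,\epsilon}/N\ \ \forall x\in X]-\dot\Sigma_X\big\|_F\le C\,R.$$ -/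

import Mathlib

open MeasureTheory ProbabilityTheory

namespace SecondMoment

noncomputable section

/-- `ℝⁿ` with the Euclidean norm. -/
abbrev E (n : ℕ) : Type := EuclideanSpace ℝ (Fin n)

/-- Square real matrices of size `n`. -/
abbrev Mat (n : ℕ) : Type := Matrix (Fin n) (Fin n) ℝ

/-- The rank-one matrix `v v*`. -/
def outer {n : ℕ} (v : E n) : Mat n := Matrix.of fun i j => v i * v j

/-- The spectral norm of a matrix: the operator norm with respect to the Euclidean norm. -/
def specNorm {n : ℕ} (A : Mat n) : ℝ := ‖Matrix.toEuclideanCLM (𝕜 := ℝ) A‖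

/-- The Frobenius norm of a matrix. -/
def frobNorm {n : ℕ} (A : Mat n) : ℝ := Real.sqrt (∑ i, ∑ j, A i j ^ 2)

/-- A random matrix has an expectation if all of its entries are integrable. -/
def HasExpectation {n : ℕ} {Ω : Type} [MeasurableSpace Ω] (P : Measure Ω) (A : Ω → Mat n) : Prop :=
  ∀ i j, Integrable (fun ω => A ω i j) P

/-- The expectation of a random matrix, taken entry by entry. -/
def expectation {n : ℕ} {Ω : Type} [MeasurableSpace Ω] (P : Measure Ω) (A : Ω → Mat n) : Mat n :=
  Matrix.of fun i j => ∫ ω, A ω i j ∂P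

/-- `P_{x,y} = (y - x)(y - x)* / ‖y - x‖²`, the orthogonal projection onto the direction of
`y - x` (and `0` if `y = x`). -/
def proj {n : ℕ} (x y : E n) : Mat n := (‖y - x‖ ^ 2)⁻¹ • outer (y - x)

/-- The `r`-interior of `D`: the points of `D` whose open ball of radius `r` lies in `D`. -/
def interiorPts {n : ℕ} (D : Set (E n)) (r : ℝ) : Set (E n) :=
  {x | x ∈ D ∧ Metric.ball x r ⊆ D}

/-- `L_f`, the supremum over `D` of the norm of the gradient. -/
def gradBound {n : ℕ} (D : Set (E n)) (f : E n → ℝ) : ℝ :=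
  sSup ((fun x => ‖gradient f x‖) '' D)

/-- `H_f`, the supremum over `D` of the spectral norm of the Hessian. -/
def hessBound {n : ℕ} (D : Set (E n)) (f : E n → ℝ) : ℝ :=
  sSup ((fun x => ‖fderiv ℝ (gradient f) x‖) '' D)

/-- `f` is twice differentiable on `D`, with bounded gradient and bounded Hessian. -/
structure IsSmooth {n : ℕ} (D : Set (E n)) (f : E n → ℝ) : Prop where
  diff : DifferentiableOn ℝ f D
  diff_gradient : DifferentiableOn ℝ (gradient f) D
  gradient_bdd : BddAbove ((fun x => ‖gradient f x‖) '' D)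
  hessian_bdd : BddAbove ((fun x => ‖fderiv ℝ (gradient f) x‖) '' D)

/-- The conditional measure `μ_{x,r}` of `μ` on the open ball of radius `r` about `x`. -/
def localMeasure {n : ℕ} (μ : Measure (E n)) (x : E n) (r : ℝ) : Measure (E n) :=
  cond μ (Metric.ball x r)

/-- Local near-isotropy of `μ` on `D`, with radius `εμ` (possibly infinite), rate `K` and with `C₀`
as the multiplicative constant of the tail bound. -/
structure LocallyNearIsotropic {n : ℕ} (D : Set (E n)) (μ : Measure (E n)) (C₀ : ℝ)
    (εμ : ENNReal) (K : ℝ) : Prop where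
  radius_pos : 0 < εμ
  rate_pos : 0 < K
  tail : ∀ r : ℝ, 0 < r → ENNReal.ofReal r ≤ εμ →
    ∀ x ∈ interiorPts D r, ∀ β : ℝ, 0 ≤ β → ∀ v : E n,
      localMeasure μ x r
          {y | β * (‖v‖ ^ 2 / n) < ‖Matrix.toEuclideanCLM (𝕜 := ℝ) (proj x y) v‖ ^ 2}
        ≤ ENNReal.ofReal (C₀ * Real.exp (-(K * β)))

/-- `ε_X`: the supremum (possibly infinite) of the radii `r` such that all points of `X` are in the
`r`-interior of `D` and any two different points of `X` are at distance at least `2 r`. -/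
def separationRadius {n N : ℕ} (D : Set (E n)) (X : Fin N → E n) : ENNReal :=
  sSup (ENNReal.ofReal ''
    {r : ℝ | (∀ i, X i ∈ interiorPts D r) ∧ ∀ i j, X i ≠ X j → 2 * r ≤ ‖X i - X j‖})

/-- `𝔹_{X,r}`, the union of the balls of radius `r` about the points of `X`. -/
def ballUnion {n N : ℕ} (X : Fin N → E n) (r : ℝ) : Set (E n) := ⋃ i, Metric.ball (X i) r

/-- The law of `Y_{X,r}`: `M` independent points from the conditional measure of `μ` on
`𝔹_{X,r}`. -/
def sampleLaw {n N : ℕ} (μ : Measure (E n)) (X : Fin N → E n) (r : ℝ) (M : ℕ) :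
    Measure (Fin M → E n) :=
  Measure.pi fun _ => cond μ (ballUnion X r)

/-- `ρ_{μ,X,r}`, i.e. `N` times the minimum over `x` in `X` of `μ(𝔹_{x,r}) / μ(𝔹_{X,r})`. -/
def rho {n N : ℕ} (μ : Measure (E n)) (X : Fin N → E n) (r : ℝ) : ℝ :=
  N * ⨅ i, μ.real (Metric.ball (X i) r) / μ.real (ballUnion X r)

open Classical in
/-- The indices of the sample points that are within distance `r` of `x`. -/
def neighbors {n M : ℕ} (r : ℝ) (Y : Fin M → E n) (x : E n) : Finset (Fin M) :=
  Finset.univ.filter fun k => Y k ∈ Metric.ball x r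

/-- `N_{x,r}`, the number of sample points within distance `r` of `x`. -/
def numNeighbors {n M : ℕ} (r : ℝ) (Y : Fin M → E n) (x : E n) : ℕ := (neighbors r Y x).card

/-- The finite-difference estimate of the gradient of `f` at `x`. -/
def gradEst {n M : ℕ} (f : E n → ℝ) (r : ℝ) (Y : Fin M → E n) (x : E n) : E n :=
  ((n : ℝ) / numNeighbors r Y x) •
    ∑ k ∈ neighbors r Y x, ((f (Y k) - f x) / ‖Y k - x‖) • (‖Y k - x‖⁻¹ • (Y k - x))

/-- The output of the algorithm, with threshold `m = N_{X,min,ε}`. -/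
def estimator {n N M : ℕ} (f : E n → ℝ) (r : ℝ) (m : ℕ) (X : Fin N → E n) (Y : Fin M → E n) :
    Mat n :=
  ((1 / (N : ℝ)) * (1 + (1 - 2 / (n : ℝ)) / (1 + 2 / (n : ℝ)) * (m : ℝ)⁻¹)⁻¹) •
    ∑ i ∈ Finset.univ.filter (fun i => m ≤ numNeighbors r Y (X i)),
      (outer (gradEst f r Y (X i)) -
        (‖gradEst f r Y (X i)‖ ^ 2 / ((1 + 2 / (n : ℝ)) * m + n + 1 - 2 / (n : ℝ))) • (1 : Mat n))

/-- The empirical second-moment matrix `Σ̇_X`. -/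
def empirical {n N : ℕ} (f : E n → ℝ) (X : Fin N → E n) : Mat n :=
  (1 / (N : ℝ)) • ∑ i, outer (gradient f (X i))

/-- The points of the `r`-interior of `D` at which `μ_{x,r}` is defined. -/
def chargedPts {n : ℕ} (D : Set (E n)) (μ : Measure (E n)) (r : ℝ) : Set (E n) :=
  {x | x ∈ interiorPts D r ∧ μ (Metric.ball x r) ≠ 0}

/-- `B'_{μ,r}`. -/
def B₁ {n : ℕ} (D : Set (E n)) (μ : Measure (E n)) (r : ℝ) : ℝ :=
  n * sSup ((fun x => specNorm
      (expectation (localMeasure μ x r) (fun y => proj x y) - (1 / (n : ℝ)) • (1 : Mat n)))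
    '' chargedPts D μ r)

/-- `B''_{μ,r}`. -/
def B₂ {n : ℕ} (D : Set (E n)) (μ : Measure (E n)) (f : E n → ℝ) (r : ℝ) : ℝ :=
  (n : ℝ) ^ 2 * sSup ((fun x =>
      frobNorm (expectation (localMeasure μ x r)
          (fun y => proj x y * outer (gradient f x) * proj x y) -
        ((2 / ((n : ℝ) * (n + 2))) • outer (gradient f x) +
          (‖gradient f x‖ ^ 2 / ((n : ℝ) * (n + 2))) • (1 : Mat n))))
    '' chargedPts D μ r)

/-- `B_{μ,r}`, where `m = N_{X,min,ε}`. -/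
def B {n : ℕ} (D : Set (E n)) (μ : Measure (E n)) (f : E n → ℝ) (r : ℝ) (m : ℕ) : ℝ :=
  2 * B₂ D μ f r / m + 4 * B₁ D μ r * (B₁ D μ r + 1) * gradBound D f ^ 2 +
    2 * gradBound D f ^ 2 * (1 + Real.sqrt n) / m

/-- The terms of the bias bound other than `B_{μ,r}`; here `M = N_{X,ε}`. -/
def remainder {n : ℕ} (D : Set (E n)) (f : E n → ℝ) (K r : ℝ) (N M : ℕ) : ℝ :=
  (n : ℝ) ^ 2 * gradBound D f ^ 2 * (N : ℝ) ^ (-10 : ℤ) +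
    r ^ 2 * hessBound D f ^ 2 * (n : ℝ) ^ 2 +
    r * gradBound D f * hessBound D f * (n : ℝ) ^ (3 / 2 : ℝ) * max (K ^ (-(1 / 2) : ℝ)) 1 *
      Real.sqrt (Real.log M)

end

end SecondMoment

/-!
Fix a point `x` of `X` and let `g = ∇f(x)`. Label every sample point by the ball of `𝔹_{X,ε}` that
contains it; the balls about different points of `X` are disjoint, so the label is unique. Given
all labels, the sample points are independent and the `k` neighbours of `x` follow `μ_{x,ε}`
(`cond_sampleLaw_cell`). Hence `∇̇` is `n / k` times a sum of `k` independent copies of a random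
vector `a`, and its conditional second moment is `n² (E[a a*] / k + (1 - 1 / k) E[a] E[a]*)`
(`expectation_outer_sum`).

By Taylor's formula `a` is within `H_f ε` of `P_{x,y} g` (`norm_dirDiff_sub_proj_le`). If the
directions had the second and fourth moments of the uniform distribution on the sphere and `k` were
equal to `m`, the correction made by the estimator would turn the second moment of
`(n / k) ∑ P_{x,y} g` into `g g*` exactly (`debias_isotropicMoment`). The correction is linear and
at most triples the Frobenius norm (`frobNorm_debias_le`), so only the distance of the second moment
from this ideal matters. It comes from three sources:

* the Taylor remainder, bounded by `n² (2 H_f ε E‖P_{x,y} g‖ + H_f² ε²)`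
  (`frobNorm_gradSecondMoment_sub_le`), where near-isotropy gives
  `E‖P_{x,y} g‖ ≤ (C₀ / (K n))^{1/2} ‖g‖` through the layer cake formula (`integral_norm_proj_le`);
* the deviation of the moments of `P_{x,y}` from isotropy, measured by `B'` and `B''`
  (`frobNorm_gradSecondMoment_sub_isotropicMoment_le`);
* the difference between `k` and `m`, of order `L_f² (1 + √n) / m`
  (`frobNorm_isotropicMoment_sub_le`).

In the first part, the points `x` with fewer than `m` neighbours contribute at most `L_f²` times the
probability of that event. The expected number of neighbours is at least `2 m`, so by Chebyshev's
inequality the probability is at most `2 / m` (`measureReal_numNeighbors_lt_le`), and the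
contribution is absorbed by the last term of `B`; so any `c > 0` will do.

In the second part every `k` equals `m`, and the last two sources vanish because the directions are
isotropic: invariance under isometries makes the fourth moment along `v` a multiple of `‖v‖⁴`, and
polarization then yields all moments in question (`integral_inner_sq_mul_inner_sq`).
-/

namespace SecondMoment

/-! ### Frobenius norm, traces and the bias correction -/

/-- The entries of a matrix as a Euclidean vector, whose norm is the Frobenius norm. -/
noncomputable def entries {n : ℕ} : Mat n →ₗ[ℝ] EuclideanSpace ℝ (Fin n × Fin n) where
  toFun A := WithLp.toLp 2 fun p => A p.1 p.2
  map_add' _ _ := rfl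
  map_smul' _ _ := rfl

theorem entries_apply {n : ℕ} (A : Mat n) (p : Fin n × Fin n) : entries A p = A p.1 p.2 := rfl

theorem frobNorm_eq_norm_entries {n : ℕ} (A : Mat n) : frobNorm A = ‖entries A‖ := by
  simp [frobNorm, entries_apply, EuclideanSpace.norm_eq, Fintype.sum_prod_type]

theorem frobNorm_nonneg {n : ℕ} (A : Mat n) : 0 ≤ frobNorm A := Real.sqrt_nonneg _

theorem frobNorm_add_le {n : ℕ} (A B : Mat n) : frobNorm (A + B) ≤ frobNorm A + frobNorm B := by
  simpa [frobNorm_eq_norm_entries] using norm_add_le (entries A) (entries B)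

theorem frobNorm_sub_le {n : ℕ} (A B : Mat n) : frobNorm (A - B) ≤ frobNorm A + frobNorm B := by
  simpa [frobNorm_eq_norm_entries] using norm_sub_le (entries A) (entries B)

theorem frobNorm_smul {n : ℕ} (c : ℝ) (A : Mat n) : frobNorm (c • A) = |c| * frobNorm A := by
  simp [frobNorm_eq_norm_entries, norm_smul]

theorem frobNorm_sum_le {n : ℕ} {ι : Type*} (s : Finset ι) (A : ι → Mat n) :
    frobNorm (∑ i ∈ s, A i) ≤ ∑ i ∈ s, frobNorm (A i) := by
  simpa [frobNorm_eq_norm_entries] using norm_sum_le s fun i => entries (A i)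

theorem sq_frobNorm {n : ℕ} (A : Mat n) : frobNorm A ^ 2 = ∑ i, ∑ j, A i j ^ 2 :=
  Real.sq_sqrt (Finset.sum_nonneg fun _ _ => Finset.sum_nonneg fun _ _ => sq_nonneg _)

theorem sum_mul_le_frobNorm_mul {n : ℕ} (A B : Mat n) :
    ∑ i, ∑ j, A i j * B i j ≤ frobNorm A * frobNorm B := by
  have h := real_inner_le_norm (entries A) (entries B)
  rw [← frobNorm_eq_norm_entries, ← frobNorm_eq_norm_entries, PiLp.inner_apply,
    Fintype.sum_prod_type] at h
  simpa [entries_apply, mul_comm] using h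

theorem frobNorm_one {n : ℕ} : frobNorm (1 : Mat n) = Real.sqrt n := by
  simp [frobNorm, Matrix.one_apply]

theorem sum_sq_coord {n : ℕ} (v : E n) : ∑ i, v i ^ 2 = ‖v‖ ^ 2 := by
  simp [EuclideanSpace.norm_sq_eq]

theorem frobNorm_vecMulVec {n : ℕ} (u v : E n) :
    frobNorm (Matrix.of fun i j => u i * v j) = ‖u‖ * ‖v‖ := by
  rw [← Real.sqrt_sq (mul_nonneg (norm_nonneg u) (norm_nonneg v)), mul_pow, ← sum_sq_coord u,
    ← sum_sq_coord v, Finset.sum_mul_sum]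
  simp [frobNorm, mul_pow]

theorem frobNorm_outer {n : ℕ} (v : E n) : frobNorm (outer v) = ‖v‖ ^ 2 := by
  rw [outer, frobNorm_vecMulVec, sq]

theorem frobNorm_outer_sub_outer_le {n : ℕ} (a b : E n) :
    frobNorm (outer a - outer b) ≤ 2 * ‖b‖ * ‖a - b‖ + ‖a - b‖ ^ 2 := by
  have h : outer a - outer b = (Matrix.of fun i j => b i * (a - b) j) +
      (Matrix.of fun i j => (a - b) i * b j) + outer (a - b) := by
    ext i j
    simp only [outer, Matrix.sub_apply, Matrix.add_apply, Matrix.of_apply, PiLp.sub_apply]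
    ring
  rw [h]
  refine (frobNorm_add_le _ _).trans ?_
  grw [frobNorm_add_le]
  rw [frobNorm_vecMulVec, frobNorm_vecMulVec, frobNorm_outer]
  linarith

theorem trace_outer {n : ℕ} (v : E n) : (outer v).trace = ‖v‖ ^ 2 := by
  rw [← sum_sq_coord]
  simp [Matrix.trace, outer, sq]

theorem abs_trace_le {n : ℕ} (A : Mat n) : |A.trace| ≤ Real.sqrt n * frobNorm A := by
  have h (s : ℝ) (hs : |s| = 1) : s * A.trace ≤ Real.sqrt n * frobNorm A := by
    have := sum_mul_le_frobNorm_mul (s • (1 : Mat n)) A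
    rw [frobNorm_smul, hs, frobNorm_one, one_mul] at this
    simpa [Matrix.trace, Matrix.one_apply, Finset.mul_sum] using this
  rw [abs_le]
  constructor
  · linarith [h (-1) (by simp)]
  · linarith [h 1 (by simp)]

theorem toEuclideanCLM_apply {n : ℕ} (A : Mat n) (v : E n) (i : Fin n) :
    Matrix.toEuclideanCLM (𝕜 := ℝ) A v i = ∑ j, A i j * v j := by
  simp [Matrix.mulVec, dotProduct]

theorem specNorm_le_frobNorm {n : ℕ} (A : Mat n) : specNorm A ≤ frobNorm A := by
  refine ContinuousLinearMap.opNorm_le_bound _ (frobNorm_nonneg A) fun v => ?_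
  refine abs_le_of_sq_le_sq' ?_ (mul_nonneg (frobNorm_nonneg A) (norm_nonneg v)) |>.2
  rw [mul_pow, sq_frobNorm, ← sum_sq_coord, ← sum_sq_coord v, Finset.sum_mul]
  gcongr with i
  rw [toEuclideanCLM_apply]
  exact Finset.sum_mul_sq_le_sq_mul_sq _ _ _

theorem toEuclideanCLM_proj {n : ℕ} (x y v : E n) :
    Matrix.toEuclideanCLM (𝕜 := ℝ) (proj x y) v =
      ((‖y - x‖ ^ 2)⁻¹ * inner ℝ (y - x) v) • (y - x) := by
  ext i
  rw [toEuclideanCLM_apply]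
  simp only [proj, outer, Matrix.smul_apply, Matrix.of_apply, smul_eq_mul, PiLp.smul_apply,
    PiLp.inner_apply, Finset.mul_sum, Finset.sum_mul]
  refine Finset.sum_congr rfl fun j _ => ?_
  simp
  ring

theorem norm_proj_le {n : ℕ} (x y v : E n) :
    ‖Matrix.toEuclideanCLM (𝕜 := ℝ) (proj x y) v‖ ≤ ‖v‖ := by
  rw [toEuclideanCLM_proj, norm_smul, norm_mul, norm_inv, norm_pow, norm_norm]
  rcases eq_or_ne (‖y - x‖) 0 with h | h
  · simp [h]
  · have := norm_inner_le_norm (𝕜 := ℝ) (y - x) v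
    have hp : 0 < ‖y - x‖ := lt_of_le_of_ne (norm_nonneg _) h.symm
    calc _ ≤ (‖y - x‖ ^ 2)⁻¹ * (‖y - x‖ * ‖v‖) * ‖y - x‖ := by gcongr
      _ = ‖v‖ := by field_simp

theorem frobNorm_proj_le_one {n : ℕ} (x y : E n) : frobNorm (proj x y) ≤ 1 := by
  rw [proj, frobNorm_smul, frobNorm_outer, abs_of_nonneg (by positivity)]
  exact inv_mul_le_one

theorem proj_mul_outer_mul_proj {n : ℕ} (x y g : E n) :
    proj x y * outer g * proj x y = outer (Matrix.toEuclideanCLM (𝕜 := ℝ) (proj x y) g) := by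
  have hs (i j) : proj x y i j = proj x y j i := by simp [proj, outer, mul_comm]
  ext i j
  simp only [Matrix.mul_apply, outer, Matrix.of_apply, toEuclideanCLM_apply, Finset.sum_mul_sum]
  simp only [Finset.sum_mul]
  rw [Finset.sum_comm]
  refine Finset.sum_congr rfl fun k _ => Finset.sum_congr rfl fun l _ => ?_
  rw [hs j l]
  ring

/-- The linear bias correction that the algorithm applies to `∇̇ ∇̇*`: it removes the multiple
`tr A / d` of the identity and rescales by `α⁻¹`. -/
noncomputable def debias {n : ℕ} (α d : ℝ) (A : Mat n) : Mat n :=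
  α⁻¹ • (A - (A.trace / d) • (1 : Mat n))

theorem debias_add {n : ℕ} (α d : ℝ) (A B : Mat n) :
    debias α d (A + B) = debias α d A + debias α d B := by
  simp only [debias, Matrix.trace_add, add_div, add_smul, ← smul_add]
  congr 1
  abel

/-- By `|tr A| ≤ √n ‖A‖_F` and `d ≥ n`, subtracting the trace term at most doubles the norm. -/
theorem frobNorm_debias_le {n : ℕ} (hn : 1 ≤ n) {α d : ℝ} (hα : 2 / 3 ≤ α) (hd : n ≤ d)
    (A : Mat n) : frobNorm (debias α d A) ≤ 3 * frobNorm A := by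
  have hn' : (0 : ℝ) < n := by exact_mod_cast hn
  have hd0 : 0 < d := hn'.trans_le hd
  have hA := frobNorm_nonneg A
  have h1 : frobNorm ((A.trace / d) • (1 : Mat n)) ≤ frobNorm A := by
    rw [frobNorm_smul, frobNorm_one, abs_div, abs_of_pos hd0]
    calc |A.trace| / d * √n ≤ (√n * frobNorm A) / n * √n := by
          gcongr
          exact abs_trace_le A
      _ = (√n * √n) / n * frobNorm A := by ring
      _ = frobNorm A := by rw [Real.mul_self_sqrt hn'.le, div_self hn'.ne', one_mul]
  have hα1 : α⁻¹ ≤ 3 / 2 := by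
    rw [inv_le_comm₀ (by linarith) (by norm_num)]
    norm_num
    linarith
  have h2 := frobNorm_sub_le A ((A.trace / d) • (1 : Mat n))
  have h3 : 0 ≤ α⁻¹ := inv_nonneg.2 (by linarith)
  rw [debias, frobNorm_smul, abs_of_nonneg h3]
  calc _ ≤ α⁻¹ * (2 * frobNorm A) := by gcongr; linarith
    _ ≤ 3 / 2 * (2 * frobNorm A) := by gcongr
    _ = _ := by ring

/-- The scaling factor of the estimator with threshold `m`. -/
noncomputable def scale (n : ℕ) (m : ℝ) : ℝ := 1 + (1 - 2 / (n : ℝ)) / (1 + 2 / (n : ℝ)) * m⁻¹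

/-- The denominator of the trace correction of the estimator with threshold `m`. -/
noncomputable def traceDenom (n : ℕ) (m : ℝ) : ℝ := (1 + 2 / (n : ℝ)) * m + n + 1 - 2 / (n : ℝ)

theorem two_thirds_le_scale {n : ℕ} (hn : 1 ≤ n) {m : ℝ} (hm : 1 ≤ m) : 2 / 3 ≤ scale n m := by
  have hn' : (1 : ℝ) ≤ n := by exact_mod_cast hn
  have h : (1 - 2 / (n : ℝ)) / (1 + 2 / (n : ℝ)) = 1 - 4 / (n + 2) := by
    field_simp
    ring
  have h4 : 4 / ((n : ℝ) + 2) ≤ 4 / 3 := by gcongr; linarith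
  have hm1 : m⁻¹ ≤ 1 := inv_le_one_of_one_le₀ hm
  have hm0 : 0 ≤ m⁻¹ := by positivity
  rw [scale, h]
  nlinarith

theorem le_traceDenom {n : ℕ} {m : ℝ} (hm : 1 ≤ m) : n ≤ traceDenom n m := by
  have h : 0 ≤ 2 / (n : ℝ) := by positivity
  rw [traceDenom]
  nlinarith

/-- The second moment of the gradient estimate from `k` sample points if `f` is affine with
gradient `g` and the directions of the sample points have the second and fourth moments of the
uniform distribution on the sphere. -/
noncomputable def isotropicMoment {n : ℕ} (k : ℝ) (g : E n) : Mat n :=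
  (n / ((n + 2) * k)) • ((2 : ℝ) • outer g + ‖g‖ ^ 2 • (1 : Mat n)) + (1 - 1 / k) • outer g

theorem debias_isotropicMoment {n : ℕ} (hn : 1 ≤ n) {m : ℝ} (hm : 1 ≤ m) (g : E n) :
    debias (scale n m) (traceDenom n m) (isotropicMoment m g) = outer g := by
  have hn' : (0 : ℝ) < n := by exact_mod_cast hn
  have hm' : 0 < m := by linarith
  have ha : scale n m = ((n + 2) * m + (n - 2)) / ((n + 2) * m) := by
    rw [scale]
    field_simp
  have ha0 : scale n m ≠ 0 := by linarith [two_thirds_le_scale hn hm]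
  have hd0 : traceDenom n m ≠ 0 := by linarith [le_traceDenom (n := n) hm]
  have hd : traceDenom n m = ((n + 2) * m + (n - 2) + n ^ 2) / n := by
    rw [traceDenom]
    field_simp
    ring
  have hnum : (n + 2) * m + (n - 2 : ℝ) ≠ 0 := by
    intro h; rw [h] at ha; simp at ha; exact ha0 ha
  have hnum' : (n + 2) * m + (n - 2 : ℝ) + n ^ 2 ≠ 0 := by
    intro h; rw [h] at hd; simp at hd; exact hd0 hd
  have ht : (isotropicMoment m g).trace / traceDenom n m = n * ‖g‖ ^ 2 / ((n + 2) * m) := by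
    simp only [isotropicMoment, Matrix.trace_add, Matrix.trace_smul, trace_outer,
      Matrix.trace_one, smul_eq_mul, Fintype.card_fin]
    rw [hd]
    field_simp
    ring
  rw [debias, ht]
  have : isotropicMoment m g - (n * ‖g‖ ^ 2 / ((n + 2) * m)) • (1 : Mat n)
      = scale n m • outer g := by
    ext i j
    simp only [isotropicMoment, ha, Matrix.sub_apply, Matrix.add_apply, Matrix.smul_apply,
      smul_eq_mul]
    field_simp
    ring
  rw [this, smul_smul, inv_mul_cancel₀ ha0, one_smul]

theorem frobNorm_isotropicMoment_sub_le {n : ℕ} {m k : ℝ} (hm : 1 ≤ m) (hk : m ≤ k) (g : E n) :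
    frobNorm (isotropicMoment k g - isotropicMoment m g) ≤
      (1 / m - 1 / k) * (3 * ‖g‖ ^ 2 * (1 + Real.sqrt n)) := by
  have hm' : 0 < m := by linarith
  have hk' : 0 < k := by linarith
  have h0 : 0 ≤ 1 / m - 1 / k := sub_nonneg.2 (one_div_le_one_div_of_le hm' hk)
  have hs := Real.sqrt_nonneg n
  have hr : (n : ℝ) / (n + 2) ≤ 1 := by
    rw [div_le_one (by positivity)]; linarith
  have : isotropicMoment k g - isotropicMoment m g = (1 / m - 1 / k) • (outer g -
      ((n : ℝ) / (n + 2)) • ((2 : ℝ) • outer g + ‖g‖ ^ 2 • (1 : Mat n))) := by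
    ext i j
    simp only [isotropicMoment, Matrix.sub_apply, Matrix.add_apply, Matrix.smul_apply,
      smul_eq_mul]
    field_simp
    ring
  rw [this, frobNorm_smul, abs_of_nonneg h0]
  gcongr
  refine (frobNorm_sub_le _ _).trans ?_
  rw [frobNorm_smul, abs_of_nonneg (by positivity), frobNorm_outer]
  have h2 := frobNorm_add_le ((2 : ℝ) • outer g) (‖g‖ ^ 2 • (1 : Mat n))
  rw [frobNorm_smul, frobNorm_smul, frobNorm_outer, frobNorm_one, abs_of_nonneg (by positivity),
    abs_of_nonneg (by positivity)] at h2
  have h3 : (n : ℝ) / (n + 2) * frobNorm ((2 : ℝ) • outer g + ‖g‖ ^ 2 • (1 : Mat n)) ≤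
      1 * (2 * ‖g‖ ^ 2 + ‖g‖ ^ 2 * √n) := by
    gcongr
    exact frobNorm_nonneg _
  nlinarith [mul_nonneg (sq_nonneg ‖g‖) hs]

/-! ### Expectations of random matrices -/

/-- Pair the random matrix with its expectation `T` and apply the Cauchy-Schwarz inequality to get
`‖T‖² ≤ ‖T‖ E‖A‖`. -/
theorem frobNorm_expectation_le {n : ℕ} {Ω : Type} [MeasurableSpace Ω] {P : Measure Ω}
    {A : Ω → Mat n} {h : Ω → ℝ} (hA : HasExpectation P A) (hh : Integrable h P)
    (hle : ∀ᵐ ω ∂P, frobNorm (A ω) ≤ h ω) : frobNorm (expectation P A) ≤ ∫ ω, h ω ∂P := by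
  set T := expectation P A with hT
  have h1 : frobNorm T ^ 2 = ∫ ω, ∑ i, ∑ j, T i j * A ω i j ∂P := by
    have hs (i j) : Integrable (fun ω => T i j * A ω i j) P := (hA i j).const_mul _
    rw [sq_frobNorm, integral_finsetSum _ fun i _ =>
      integrable_finsetSum _ fun j _ => hs i j]
    refine Finset.sum_congr rfl fun i _ => ?_
    rw [integral_finsetSum _ fun j _ => hs i j]
    refine Finset.sum_congr rfl fun j _ => ?_
    rw [integral_const_mul, sq]
    rfl
  have h2 : frobNorm T ^ 2 ≤ frobNorm T * ∫ ω, h ω ∂P := by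
    rw [h1, ← integral_const_mul]
    refine integral_mono_ae (integrable_finsetSum _ fun i _ => integrable_finsetSum _ fun j _ =>
      (hA i j).const_mul _) (hh.const_mul _) ?_
    filter_upwards [hle] with ω hω
    exact (sum_mul_le_frobNorm_mul _ _).trans (mul_le_mul_of_nonneg_left hω (frobNorm_nonneg _))
  rcases (frobNorm_nonneg T).eq_or_lt with h0 | h0
  · rw [← h0]
    refine integral_nonneg_of_ae ?_
    filter_upwards [hle] with ω hω using (frobNorm_nonneg _).trans hω
  · rw [sq] at h2
    exact le_of_mul_le_mul_left h2 h0

section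

variable {n : ℕ} {Ω : Type} [MeasurableSpace Ω] {P : Measure Ω} {A B : Ω → Mat n}

theorem HasExpectation.congr (hA : HasExpectation P A) (h : A =ᵐ[P] B) : HasExpectation P B :=
  fun i j => (hA i j).congr (h.fun_comp fun T => T i j)

theorem expectation_congr (h : A =ᵐ[P] B) : expectation P A = expectation P B := by
  ext i j
  exact integral_congr_ae (h.fun_comp fun T => T i j)

theorem HasExpectation.sub (hA : HasExpectation P A) (hB : HasExpectation P B) :
    HasExpectation P fun ω => A ω - B ω := fun i j => (hA i j).sub (hB i j)

theorem HasExpectation.smul (c : ℝ) (hA : HasExpectation P A) :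
    HasExpectation P fun ω => c • A ω := fun i j => (hA i j).const_mul c

theorem expectation_sub (hA : HasExpectation P A) (hB : HasExpectation P B) :
    expectation P (fun ω => A ω - B ω) = expectation P A - expectation P B := by
  ext i j
  exact integral_sub (hA i j) (hB i j)

theorem expectation_smul (c : ℝ) : expectation P (fun ω => c • A ω) = c • expectation P A := by
  ext i j
  exact integral_const_mul c _

theorem HasExpectation.sum {ι : Type*} {s : Finset ι} {F : ι → Ω → Mat n}
    (h : ∀ i ∈ s, HasExpectation P (F i)) : HasExpectation P fun ω => ∑ i ∈ s, F i ω := by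
  intro i j
  simp only [Matrix.sum_apply]
  exact integrable_finsetSum _ fun k hk => h k hk i j

theorem expectation_sum {ι : Type*} {s : Finset ι} {F : ι → Ω → Mat n}
    (h : ∀ i ∈ s, HasExpectation P (F i)) :
    expectation P (fun ω => ∑ i ∈ s, F i ω) = ∑ i ∈ s, expectation P (F i) := by
  ext i j
  simp only [expectation, Matrix.of_apply, Matrix.sum_apply]
  exact integral_finsetSum _ fun k hk => h k hk i j

theorem HasExpectation.debias (α d : ℝ) (hA : HasExpectation P A) :
    HasExpectation P fun ω => debias α d (A ω) := by
  intro i j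
  simp only [SecondMoment.debias, Matrix.smul_apply, Matrix.sub_apply, smul_eq_mul, Matrix.trace,
    Matrix.diag_apply]
  exact ((hA i j).sub (((integrable_finsetSum _ fun k _ => hA k k).div_const _).mul_const
    _)).const_mul _

theorem expectation_debias (α d : ℝ) (hA : HasExpectation P A) :
    expectation P (fun ω => debias α d (A ω)) = debias α d (expectation P A) := by
  ext i j
  simp only [debias, expectation, Matrix.of_apply, Matrix.smul_apply, Matrix.sub_apply,
    smul_eq_mul, Matrix.trace, Matrix.diag_apply]
  have ht := integrable_finsetSum Finset.univ fun k _ => hA k k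
  rw [integral_const_mul, integral_sub (hA i j) ((ht.div_const _).mul_const _),
    integral_mul_const, integral_div, integral_finsetSum _ fun k _ => hA k k]

theorem expectation_const [IsProbabilityMeasure P] (T : Mat n) :
    expectation P (fun _ => T) = T := by
  ext i j
  simp [expectation]

theorem hasExpectation_const [IsProbabilityMeasure P] (T : Mat n) :
    HasExpectation P (fun _ => T) := fun _ _ => integrable_const _

theorem integral_cond_eq [IsFiniteMeasure P] {s : Set Ω} (u : Ω → ℝ) :
    ∫ ω in s, u ω ∂P = P.real s * ∫ ω, u ω ∂(ProbabilityTheory.cond P s) := by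
  rcases eq_or_ne (P s) 0 with h | h
  · simp [Measure.real, h, setIntegral_measure_zero]
  · rw [ProbabilityTheory.cond, integral_smul_measure, smul_eq_mul, ← mul_assoc,
      Measure.real, ENNReal.toReal_inv,
      mul_inv_cancel₀, one_mul]
    exact ENNReal.toReal_ne_zero.2 ⟨h, measure_ne_top _ _⟩

theorem integrableOn_of_cond [IsFiniteMeasure P] {s : Set Ω} {u : Ω → ℝ}
    (h : P s ≠ 0 → Integrable u (ProbabilityTheory.cond P s)) : IntegrableOn u s P := by
  by_cases h0 : P s = 0
  · rw [IntegrableOn, Measure.restrict_eq_zero.2 h0]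
    exact integrable_zero_measure
  · have := h h0
    rwa [ProbabilityTheory.cond, integrable_smul_measure (by simp) (by simpa using h0)] at this

theorem hasExpectation_of_partition [IsProbabilityMeasure P] {ι : Type*} [Fintype ι]
    {S : ι → Set Ω} (hS : ∀ᵐ ω ∂P, ∃ c, ω ∈ S c)
    (hA : ∀ c, P (S c) ≠ 0 → HasExpectation (cond P (S c)) A) : HasExpectation P A := by
  intro i j
  have hr : P.restrict (⋃ c, S c) = P :=
    Measure.restrict_eq_self_of_ae_mem (by simpa [Set.mem_iUnion] using hS)
  rw [← hr]
  exact integrableOn_finite_iUnion.2 fun c => integrableOn_of_cond fun h => hA c h i j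

/-- The law of total expectation for a finite partition into the events `S c`. -/
theorem expectation_eq_sum_partition [IsProbabilityMeasure P] {ι : Type*} [Fintype ι]
    {S : ι → Set Ω} (hSm : ∀ c, MeasurableSet (S c)) (hd : Pairwise (Function.onFun Disjoint S))
    (hS : ∀ᵐ ω ∂P, ∃ c, ω ∈ S c)
    (hA : ∀ c, P (S c) ≠ 0 → HasExpectation (cond P (S c)) A) :
    expectation P A = ∑ c, P.real (S c) • expectation (cond P (S c)) A := by
  ext i j
  have hr : P.restrict (⋃ c, S c) = P :=
    Measure.restrict_eq_self_of_ae_mem (by simpa [Set.mem_iUnion] using hS)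
  simp only [expectation, Matrix.of_apply, Matrix.sum_apply, Matrix.smul_apply, smul_eq_mul]
  nth_rw 1 [← hr]
  rw [integral_iUnion_fintype hSm hd fun c => integrableOn_of_cond fun h => hA c h i j]
  exact Finset.sum_congr rfl fun c _ => integral_cond_eq _

theorem sum_measureReal_partition [IsProbabilityMeasure P] {ι : Type*} [Fintype ι]
    {S : ι → Set Ω} (hSm : ∀ c, MeasurableSet (S c)) (hd : Pairwise (Function.onFun Disjoint S))
    (hS : ∀ᵐ ω ∂P, ∃ c, ω ∈ S c) : ∑ c, P.real (S c) = 1 := by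
  rw [← measureReal_iUnion_fintype hd hSm]
  rw [measureReal_def, prob_compl_eq_zero_iff (MeasurableSet.iUnion hSm) |>.1]
  · simp
  · rw [ae_iff] at hS
    convert hS using 2
    ext
    simp

theorem frobNorm_expectation_sub_le_of_partition [IsProbabilityMeasure P] {ι : Type*} [Fintype ι]
    {S : ι → Set Ω} (hSm : ∀ c, MeasurableSet (S c)) (hd : Pairwise (Function.onFun Disjoint S))
    (hS : ∀ᵐ ω ∂P, ∃ c, ω ∈ S c)
    (hA : ∀ c, P (S c) ≠ 0 → HasExpectation (cond P (S c)) A) (T : Mat n) {b : ι → ℝ}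
    (hb : ∀ c, P (S c) ≠ 0 → frobNorm (expectation (cond P (S c)) A - T) ≤ b c) :
    frobNorm (expectation P A - T) ≤ ∑ c, P.real (S c) * b c := by
  have h1 : expectation P A - T =
      ∑ c, P.real (S c) • (expectation (cond P (S c)) A - T) := by
    simp only [smul_sub, Finset.sum_sub_distrib, ← Finset.sum_smul]
    rw [sum_measureReal_partition hSm hd hS, one_smul,
      expectation_eq_sum_partition hSm hd hS hA]
  rw [h1]
  refine (frobNorm_sum_le _ _).trans (Finset.sum_le_sum fun c _ => ?_)
  rw [frobNorm_smul, abs_of_nonneg measureReal_nonneg]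
  rcases eq_or_ne (P (S c)) 0 with h | h
  · simp [Measure.real, h]
  · exact mul_le_mul_of_nonneg_left (hb c h) measureReal_nonneg

end

/-! ### Second moments of sums of independent vectors -/

/-- Conditioning a power of `ν` on a product event conditions the factors separately. -/
theorem cond_pi {ι : Type*} [Fintype ι] {α : Type*} [MeasurableSpace α] (ν : Measure α)
    [IsProbabilityMeasure ν] {S : ι → Set α} (hS : ∀ k, MeasurableSet (S k))
    (h0 : ∀ k, ν (S k) ≠ 0) :
    cond (Measure.pi fun _ : ι => ν) (Set.pi Set.univ S) = Measure.pi fun k => cond ν (S k) := by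
  have (k : ι) : IsProbabilityMeasure (cond ν (S k)) := cond_isProbabilityMeasure (h0 k)
  refine (Measure.pi_eq fun s hs => ?_).symm
  rw [cond_apply (MeasurableSet.univ_pi hS), ← Set.pi_inter_distrib, Measure.pi_pi, Measure.pi_pi]
  simp only [cond_apply (hS _)]
  rw [Finset.prod_mul_distrib, ENNReal.prod_inv_distrib]
  intro i _ j _ _
  exact Or.inl (h0 i)

theorem integral_apply {n : ℕ} {Ω : Type*} [MeasurableSpace Ω] {P : Measure Ω} {a : Ω → E n}
    (ha : Integrable a P) (i : Fin n) : (∫ ω, a ω ∂P) i = ∫ ω, a ω i ∂P :=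
  ((EuclideanSpace.proj (𝕜 := ℝ) i : E n →L[ℝ] ℝ).integral_comp_comm ha).symm

theorem hasExpectation_outer {n : ℕ} {Ω : Type} [MeasurableSpace Ω] {P : Measure Ω}
    {a : Ω → E n} (ha : MemLp a 2 P) : HasExpectation P fun ω => outer (a ω) := by
  have h (i : Fin n) : MemLp (fun ω => a ω i) 2 P :=
    ha.continuousLinearMap_comp (EuclideanSpace.proj (𝕜 := ℝ) i : E n →L[ℝ] ℝ)
  exact fun i j => (h i).integrable_mul (h j)

/-- The second moment of the sum of the vectors `a (Y k)`, `k ∈ S`, for independent `Y k` such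
that those with `k ∈ S` have law `lam`. -/
theorem expectation_outer_sum {n M : ℕ} {Q : Fin M → Measure (E n)}
    [∀ k, IsProbabilityMeasure (Q k)] {lam : Measure (E n)} [IsProbabilityMeasure lam]
    {S : Finset (Fin M)} (hS : ∀ k ∈ S, Q k = lam) {a : E n → E n} (ha : MemLp a 2 lam) :
    HasExpectation (Measure.pi Q) (fun Y => outer (∑ k ∈ S, a (Y k))) ∧
    expectation (Measure.pi Q) (fun Y => outer (∑ k ∈ S, a (Y k))) =
      (S.card : ℝ) • expectation lam (fun y => outer (a y)) +
        ((S.card : ℝ) * (S.card - 1)) • outer (∫ y, a y ∂lam) := by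
  have hi := ha.integrable one_le_two
  have hc (i : Fin n) : Integrable (fun y => a y i) lam :=
    (EuclideanSpace.proj (𝕜 := ℝ) i : E n →L[ℝ] ℝ).integrable_comp hi
  have hk : ∀ k ∈ S, ∀ i, Integrable (fun Y : Fin M → E n => a (Y k) i) (Measure.pi Q) :=
    fun k hk i => integrable_comp_eval (μ := Q) (i := k) (f := fun y => a y i)
      (by rw [hS k hk]; exact hc i)
  have key : ∀ k ∈ S, ∀ l ∈ S, ∀ i j,
      Integrable (fun Y : Fin M → E n => a (Y k) i * a (Y l) j) (Measure.pi Q) ∧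
      ∫ Y, a (Y k) i * a (Y l) j ∂(Measure.pi Q) =
        if k = l then expectation lam (fun y => outer (a y)) i j
        else outer (∫ y, a y ∂lam) i j := by
    intro k hkS l hlS i j
    split_ifs with h
    · subst h
      have := hasExpectation_outer ha i j
      simp only [outer, Matrix.of_apply] at this
      refine ⟨integrable_comp_eval (μ := Q) (i := k) (f := fun y => a y i * a y j)
        (by rwa [hS k hkS]), ?_⟩
      rw [integral_comp_eval (μ := Q) (i := k) (f := fun y => a y i * a y j)
        (by rw [hS k hkS]; exact this.aestronglyMeasurable), hS k hkS]
      rfl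
    · have hind : IndepFun (fun Y : Fin M → E n => a (Y k) i) (fun Y => a (Y l) j)
          (Measure.pi Q) := by
        -- Only the factors at `k` and `l` are known to be measurable, so the others are set to `0`.
        let f : Fin M → E n → ℝ := fun r y => if r = k then a y i else if r = l then a y j else 0
        have hf : ∀ r, AEMeasurable (f r) (Q r) := by
          intro r
          by_cases h1 : r = k
          · simp only [f, h1, if_true, hS k hkS]
            exact (hc i).aestronglyMeasurable.aemeasurable
          · by_cases h2 : r = l
            · simp only [f, h2, if_true, hS l hlS, Ne.symm h, if_false]
              exact (hc j).aestronglyMeasurable.aemeasurable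
            · simp only [f, h1, h2, if_false]
              exact aemeasurable_const
        have := (iIndepFun_pi hf).indepFun h
        simpa [f, Ne.symm h] using this
      refine ⟨hind.integrable_mul (hk k hkS i) (hk l hlS j), ?_⟩
      rw [hind.integral_fun_mul_eq_mul_integral (hk k hkS i).aestronglyMeasurable
        (hk l hlS j).aestronglyMeasurable,
        integral_comp_eval (μ := Q) (i := k) (f := fun y => a y i)
          (by rw [hS k hkS]; exact (hc i).aestronglyMeasurable),
        integral_comp_eval (μ := Q) (i := l) (f := fun y => a y j)
          (by rw [hS l hlS]; exact (hc j).aestronglyMeasurable), hS k hkS, hS l hlS]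
      simp only [outer, Matrix.of_apply, integral_apply hi]
  have hexp (Y : Fin M → E n) (i j : Fin n) : outer (∑ k ∈ S, a (Y k)) i j =
      ∑ k ∈ S, ∑ l ∈ S, a (Y k) i * a (Y l) j := by
    simp [outer, Finset.sum_mul_sum]
  constructor
  · intro i j
    simp only [hexp]
    exact integrable_finsetSum _ fun k hk => integrable_finsetSum _ fun l hl =>
      (key k hk l hl i j).1
  · ext i j
    rw [expectation, Matrix.of_apply]
    simp only [hexp]
    rw [integral_finsetSum _ fun k hk => integrable_finsetSum _ fun l hl =>
      (key k hk l hl i j).1]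
    have : ∀ k ∈ S, ∫ Y, ∑ l ∈ S, a (Y k) i * a (Y l) j ∂(Measure.pi Q) =
        expectation lam (fun y => outer (a y)) i j +
          ((S.card : ℝ) - 1) * outer (∫ y, a y ∂lam) i j := by
      intro k hk
      rw [integral_finsetSum _ fun l hl => (key k hk l hl i j).1,
        Finset.sum_congr rfl fun l hl => (key k hk l hl i j).2,
        ← Finset.add_sum_erase S _ hk]
      rw [if_pos rfl, Finset.sum_congr rfl fun l hl => if_neg (Finset.ne_of_mem_erase hl).symm,
        Finset.sum_const, Finset.card_erase_of_mem hk, nsmul_eq_mul,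
        Nat.cast_sub (Finset.card_pos.2 ⟨k, hk⟩), Nat.cast_one]
    rw [Finset.sum_congr rfl this, Finset.sum_const, nsmul_eq_mul]
    simp only [Matrix.add_apply, Matrix.smul_apply, smul_eq_mul]
    ring

/-! ### Finite differences and Taylor's formula -/

theorem norm_gradient_le_gradBound {n : ℕ} {D : Set (E n)} {f : E n → ℝ} (hf : IsSmooth D f)
    {x : E n} (hx : x ∈ D) : ‖gradient f x‖ ≤ gradBound D f :=
  le_csSup hf.gradient_bdd ⟨x, hx, rfl⟩

theorem norm_hessian_le_hessBound {n : ℕ} {D : Set (E n)} {f : E n → ℝ} (hf : IsSmooth D f)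
    {x : E n} (hx : x ∈ D) : ‖fderiv ℝ (gradient f) x‖ ≤ hessBound D f :=
  le_csSup hf.hessian_bdd ⟨x, hx, rfl⟩

theorem hessBound_nonneg {n : ℕ} (D : Set (E n)) (f : E n → ℝ) : 0 ≤ hessBound D f :=
  Real.sSup_nonneg fun _ ⟨_, _, h⟩ => h ▸ norm_nonneg _

theorem gradBound_nonneg {n : ℕ} (D : Set (E n)) (f : E n → ℝ) : 0 ≤ gradBound D f :=
  Real.sSup_nonneg fun _ ⟨_, _, h⟩ => h ▸ norm_nonneg _

theorem abs_taylor_le {n : ℕ} {D : Set (E n)} {f : E n → ℝ} (hD : IsOpen D) (hf : IsSmooth D f)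
    {x y : E n} {r : ℝ} (hx : Metric.ball x r ⊆ D) (hy : y ∈ Metric.ball x r) :
    |f y - f x - inner ℝ (y - x) (gradient f x)| ≤ hessBound D f * ‖y - x‖ * ‖y - x‖ := by
  have hr : 0 < r := Metric.pos_of_mem_ball hy
  have hsub : Metric.closedBall x ‖y - x‖ ⊆ Metric.ball x r :=
    Metric.closedBall_subset_ball (by simpa [dist_eq_norm] using hy)
  have hH := hessBound_nonneg D f
  have hlip : ∀ w ∈ Metric.ball x r, ‖gradient f w - gradient f x‖ ≤ hessBound D f * ‖w - x‖ :=
    fun w hw => Convex.norm_image_sub_le_of_norm_fderiv_le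
      (fun z hz => (hf.diff_gradient z (hx hz)).differentiableAt (hD.mem_nhds (hx hz)))
      (fun z hz => norm_hessian_le_hessBound hf (hx hz)) (convex_ball x r)
      (Metric.mem_ball_self hr) hw
  have hb : ∀ w ∈ Metric.closedBall x ‖y - x‖, ‖fderiv ℝ f w - fderiv ℝ f x‖ ≤
      hessBound D f * ‖y - x‖ := by
    intro w hw
    have h1 : ‖fderiv ℝ f w - fderiv ℝ f x‖ = ‖gradient f w - gradient f x‖ := by
      rw [gradient, gradient, ← map_sub, LinearIsometryEquiv.norm_map]
    rw [h1]
    refine (hlip w (hsub hw)).trans (mul_le_mul_of_nonneg_left ?_ hH)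
    simpa [dist_eq_norm] using hw
  have := Convex.norm_image_sub_le_of_norm_hasFDerivWithin_le' (f := f) (φ := fderiv ℝ f x)
    (fun w hw => ((hf.diff w (hx (hsub hw))).differentiableAt
      (hD.mem_nhds (hx (hsub hw)))).hasFDerivAt.hasFDerivWithinAt) hb (convex_closedBall _ _)
    (Metric.mem_closedBall_self (norm_nonneg _)) (y := y) (by simp [dist_eq_norm])
  rw [real_inner_comm]
  simpa [gradient] using this

/-- The contribution `(f y - f x) / ‖y - x‖ * (y - x) / ‖y - x‖` of the sample point `y` to the
gradient estimate at `x`. -/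
noncomputable def dirDiff {n : ℕ} (f : E n → ℝ) (x y : E n) : E n :=
  ((f y - f x) / ‖y - x‖) • (‖y - x‖⁻¹ • (y - x))

theorem norm_dirDiff_sub_proj_le {n : ℕ} {D : Set (E n)} {f : E n → ℝ} (hD : IsOpen D)
    (hf : IsSmooth D f) {x y : E n} {r : ℝ} (hx : Metric.ball x r ⊆ D)
    (hy : y ∈ Metric.ball x r) :
    ‖dirDiff f x y - Matrix.toEuclideanCLM (𝕜 := ℝ) (proj x y) (gradient f x)‖ ≤
      hessBound D f * r := by
  have h1 : dirDiff f x y - Matrix.toEuclideanCLM (𝕜 := ℝ) (proj x y) (gradient f x) =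
      ((‖y - x‖ ^ 2)⁻¹ * (f y - f x - inner ℝ (y - x) (gradient f x))) • (y - x) := by
    rw [dirDiff, toEuclideanCLM_proj, smul_smul, ← sub_smul]
    congr 1
    rw [sq, mul_inv]
    ring
  have hz : ‖y - x‖ < r := by simpa [dist_eq_norm] using hy
  have hH := hessBound_nonneg D f
  rw [h1, norm_smul, norm_mul, Real.norm_eq_abs (_ - _), norm_inv, norm_pow, norm_norm]
  rcases (norm_nonneg (y - x)).eq_or_lt with h | h
  · rw [← h, mul_zero]
    rw [← h] at hz
    positivity
  · calc _ ≤ (‖y - x‖ ^ 2)⁻¹ * (hessBound D f * ‖y - x‖ * ‖y - x‖) * ‖y - x‖ := by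
          gcongr
          exact abs_taylor_le hD hf hx hy
      _ = hessBound D f * ‖y - x‖ := by field_simp
      _ ≤ _ := by gcongr

theorem aestronglyMeasurable_dirDiff {n : ℕ} {D : Set (E n)} {f : E n → ℝ}
    (hf : IsSmooth D f) (μ : Measure (E n)) {x : E n} {r : ℝ} (hx : Metric.ball x r ⊆ D) :
    AEStronglyMeasurable (dirDiff f x) (localMeasure μ x r) := by
  have h1 : AEStronglyMeasurable f (μ.restrict (Metric.ball x r)) :=
    (hf.diff.continuousOn.mono hx).aestronglyMeasurable Metric.isOpen_ball.measurableSet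
  have h2 : AEStronglyMeasurable f (localMeasure μ x r) := h1.smul_measure _
  have h3 : Measurable fun y : E n => ‖y - x‖⁻¹ := by fun_prop
  have h4 : Measurable fun y : E n => ‖y - x‖⁻¹ • (y - x) := by fun_prop
  have h5 : dirDiff f x = fun y => ((f y - f x) * ‖y - x‖⁻¹) • (‖y - x‖⁻¹ • (y - x)) := by
    ext1 y
    rw [dirDiff, div_eq_mul_inv]
  rw [h5]
  exact ((h2.sub aestronglyMeasurable_const).mul h3.aestronglyMeasurable).smul
    h4.aestronglyMeasurable

theorem measurable_proj_apply {n : ℕ} (x g : E n) :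
    Measurable fun y => Matrix.toEuclideanCLM (𝕜 := ℝ) (proj x y) g := by
  simp only [toEuclideanCLM_proj]
  fun_prop

theorem gradEst_eq {n M : ℕ} (f : E n → ℝ) (r : ℝ) (Y : Fin M → E n) (x : E n) :
    gradEst f r Y x = ((n : ℝ) / (neighbors r Y x).card) • ∑ k ∈ neighbors r Y x,
      dirDiff f x (Y k) := rfl

/-! ### Near-isotropy -/

/-- By the layer cake formula, the tail bound of near-isotropy bounds the mean square length of
the projection of `g` to a random direction. -/
theorem integral_norm_proj_le {n : ℕ} (hn : 1 ≤ n) {D : Set (E n)} {μ : Measure (E n)}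
    {C₀ K : ℝ} {εμ : ENNReal} (hC : 0 < C₀) (hμ : LocallyNearIsotropic D μ C₀ εμ K) {r : ℝ}
    (hr : 0 < r) (hrμ : ENNReal.ofReal r ≤ εμ) {x : E n} (hx : x ∈ interiorPts D r)
    [IsProbabilityMeasure (localMeasure μ x r)] (g : E n) :
    ∫ y, ‖Matrix.toEuclideanCLM (𝕜 := ℝ) (proj x y) g‖ ∂(localMeasure μ x r) ≤
      Real.sqrt (C₀ / (K * n)) * ‖g‖ := by
  set lam := localMeasure μ x r
  set u : E n → ℝ := fun y => ‖Matrix.toEuclideanCLM (𝕜 := ℝ) (proj x y) g‖ with hu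
  have hK := hμ.rate_pos
  have hn' : (0 : ℝ) < n := by exact_mod_cast hn
  have hum : Measurable u := (measurable_proj_apply x g).norm
  have hub : ∀ y, u y ≤ ‖g‖ := fun y => norm_proj_le x y g
  have hu0 : ∀ y, 0 ≤ u y := fun y => norm_nonneg _
  rcases (norm_nonneg g).eq_or_lt with hg | hg
  · have : u = 0 := by
      ext y
      exact le_antisymm ((hub y).trans hg.ge) (hu0 y)
    rw [this, ← hg]
    simp
  have hL2 : MemLp u 2 lam := MemLp.of_bound hum.aestronglyMeasurable ‖g‖
    (Filter.Eventually.of_forall fun y => by rw [Real.norm_of_nonneg (hu0 y)]; exact hub y)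
  have hsq : (∫ y, u y ∂lam) ^ 2 ≤ ∫ y, u y ^ 2 ∂lam := by
    have h1 := variance_nonneg u lam
    rw [variance_eq_sub hL2] at h1
    simpa using h1
  have hi2 : Integrable (fun y => u y ^ 2) lam := hL2.integrable_sq
  set b : ℝ := K * n / ‖g‖ ^ 2 with hb
  have hb0 : 0 < b := by positivity
  have htail : ∀ t ∈ Set.Ioi (0 : ℝ), lam.real {y | t < u y ^ 2} ≤ C₀ * Real.exp (-b * t) := by
    intro t ht
    have h1 := hμ.tail r hr hrμ x hx (t * n / ‖g‖ ^ 2) (by have := ht.out.le; positivity) g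
    have h2 : t * n / ‖g‖ ^ 2 * (‖g‖ ^ 2 / n) = t := by field_simp
    rw [h2] at h1
    have h3 := ENNReal.toReal_mono ENNReal.ofReal_ne_top h1
    rw [ENNReal.toReal_ofReal (by positivity)] at h3
    refine h3.trans_eq ?_
    congr 2
    rw [hb]
    ring
  have hexp : IntegrableOn (fun t => C₀ * Real.exp (-b * t)) (Set.Ioi 0) :=
    (exp_neg_integrableOn_Ioi 0 hb0).const_mul C₀
  have hmom : ∫ y, u y ^ 2 ∂lam ≤ C₀ / (K * n) * ‖g‖ ^ 2 := by
    rw [hi2.integral_eq_integral_meas_lt (Filter.Eventually.of_forall fun y => sq_nonneg _)]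
    calc ∫ t in Set.Ioi 0, lam.real {y | t < u y ^ 2}
        ≤ ∫ t in Set.Ioi 0, C₀ * Real.exp (-b * t) := by
          refine integral_mono_of_nonneg (Filter.Eventually.of_forall fun t => measureReal_nonneg)
            hexp ?_
          filter_upwards [ae_restrict_mem measurableSet_Ioi] with t ht using htail t ht
      _ = C₀ * (1 / b) := by
          rw [integral_const_mul, integral_exp_mul_Ioi (by linarith)]
          simp
      _ = _ := by rw [hb]; field_simp
  refine abs_le_of_sq_le_sq' (hsq.trans (hmom.trans_eq ?_)) (by positivity) |>.2
  rw [mul_pow, Real.sq_sqrt (by positivity)]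

/-! ### Moments of uniformly distributed directions -/

theorem toEuclideanCLM_outer {n : ℕ} (u v : E n) :
    Matrix.toEuclideanCLM (𝕜 := ℝ) (outer u) v = inner ℝ u v • u := by
  ext i
  rw [toEuclideanCLM_apply]
  simp only [outer, Matrix.of_apply, PiLp.smul_apply, smul_eq_mul, PiLp.inner_apply,
    Finset.sum_mul]
  refine Finset.sum_congr rfl fun j _ => ?_
  simp
  ring

/-- The unit vector in the direction of `y - x`. -/
noncomputable def direction {n : ℕ} (x y : E n) : E n := ‖y - x‖⁻¹ • (y - x)

theorem outer_direction {n : ℕ} (x y : E n) : outer (direction x y) = proj x y := by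
  ext i j
  simp only [outer, direction, proj, Matrix.of_apply, Matrix.smul_apply, PiLp.smul_apply,
    smul_eq_mul, sq, mul_inv]
  ring

theorem norm_direction_le_one {n : ℕ} (x y : E n) : ‖direction x y‖ ≤ 1 := by
  rw [direction, norm_smul, norm_inv, norm_norm]
  exact inv_mul_le_one

theorem measurable_direction {n : ℕ} (x : E n) : Measurable (direction x) := by
  unfold direction
  fun_prop

theorem toEuclideanCLM_proj_eq {n : ℕ} (x y v : E n) :
    Matrix.toEuclideanCLM (𝕜 := ℝ) (proj x y) v =
      inner ℝ (direction x y) v • direction x y := by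
  rw [← outer_direction, toEuclideanCLM_outer]

/-- The mean of a function of the direction from the centre of a ball to a uniformly distributed
point is invariant under linear isometries. -/
theorem integral_direction_isometry {n : ℕ} (x : E n) (r : ℝ) (R : E n ≃ₗᵢ[ℝ] E n)
    (F : E n → ℝ) :
    ∫ y, F (R (direction x y)) ∂(localMeasure volume x r) =
      ∫ y, F (direction x y) ∂(localMeasure volume x r) := by
  let T : E n ≃ᵢ E n := ((IsometryEquiv.subRight x).trans R.toIsometryEquiv).trans
    (IsometryEquiv.addRight x)
  have hT (y : E n) : T y = R (y - x) + x := rfl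
  have hTm : MeasurePreserving T volume volume :=
    ((measurePreserving_add_right volume x).comp R.measurePreserving).comp
      (measurePreserving_sub_right volume x)
  have hpre : T ⁻¹' Metric.ball x r = Metric.ball x r := by
    ext y
    rw [Set.mem_preimage, Metric.mem_ball, Metric.mem_ball, hT, dist_eq_norm, dist_eq_norm,
      add_sub_cancel_right, R.norm_map]
  have hdir (y : E n) : direction x (T y) = R (direction x y) := by
    rw [direction, hT, add_sub_cancel_right, R.norm_map, direction, map_smul]
  have := hTm.setIntegral_preimage_emb T.toHomeomorph.measurableEmbedding
    (fun y => F (direction x y)) (Metric.ball x r)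
  rw [hpre] at this
  simp only [hdir] at this
  simp only [localMeasure, ProbabilityTheory.cond, integral_smul_measure, this]

theorem exists_isometry_of_norm_eq {n : ℕ} {v w : E n} (h : ‖v‖ = ‖w‖) :
    ∃ R : E n ≃ₗᵢ[ℝ] E n, R v = w :=
  ⟨(ℝ ∙ (v - w))ᗮ.reflection, Submodule.reflection_sub h⟩

section

variable {n : ℕ} (x : E n) {r : ℝ}

theorem isProbabilityMeasure_localMeasure {μ : Measure (E n)} [IsFiniteMeasure μ]
    (h : μ (Metric.ball x r) ≠ 0) : IsProbabilityMeasure (localMeasure μ x r) :=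
  cond_isProbabilityMeasure h

theorem isProbabilityMeasure_localMeasure_volume (hr : 0 < r) :
    IsProbabilityMeasure (localMeasure volume x r) :=
  cond_isProbabilityMeasure_of_finite (Metric.measure_ball_pos volume x hr).ne'
    measure_ball_lt_top.ne

/-- The fourth moment of the component of a uniformly random direction along `e`. -/
noncomputable def fourthMoment (x : E n) (r : ℝ) (e : E n) : ℝ :=
  ∫ y, inner ℝ (direction x y) e ^ 4 ∂(localMeasure volume x r)

theorem integrable_inner_pow [IsProbabilityMeasure (localMeasure volume x r)] (v w : E n)
    (k l : ℕ) :
    Integrable (fun y => inner ℝ (direction x y) v ^ k * inner ℝ (direction x y) w ^ l)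
      (localMeasure volume x r) := by
  have hm (v : E n) : Measurable fun y => inner ℝ (direction x y) v := by
    have := measurable_direction x
    fun_prop
  refine Integrable.of_bound (((hm v).pow_const k).mul ((hm w).pow_const l)).aestronglyMeasurable
    (‖v‖ ^ k * ‖w‖ ^ l) (Filter.Eventually.of_forall fun y => ?_)
  have hb (v : E n) : ‖(inner ℝ (direction x y) v : ℝ)‖ ≤ ‖v‖ := by
    refine (norm_inner_le_norm _ _).trans ?_
    exact mul_le_of_le_one_left (norm_nonneg _) (norm_direction_le_one x y)
  rw [norm_mul, norm_pow, norm_pow]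
  gcongr <;> exact hb _

/-- Rotation invariance makes the fourth moment along `v` a multiple of `‖v‖ ^ 4`. -/
theorem exists_fourthMoment_eq (r : ℝ) : ∃ c, ∀ v : E n, fourthMoment x r v = c * ‖v‖ ^ 4 := by
  by_cases h : ∃ e : E n, ‖e‖ = 1
  · obtain ⟨e, he⟩ := h
    refine ⟨fourthMoment x r e, fun v => ?_⟩
    obtain ⟨R, hR⟩ := exists_isometry_of_norm_eq (v := v) (w := ‖v‖ • e) (by simp [norm_smul, he])
    have h1 := integral_direction_isometry x r R fun u => inner ℝ u (‖v‖ • e) ^ 4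
    rw [← hR] at h1
    simp only [LinearIsometryEquiv.inner_map_map] at h1
    rw [fourthMoment, h1, hR, fourthMoment, ← integral_mul_const]
    refine integral_congr_ae (Filter.Eventually.of_forall fun y => ?_)
    simp only [inner_smul_right]
    ring
  · refine ⟨0, fun v => ?_⟩
    have hv : v = 0 := by
      by_contra hv
      exact h ⟨‖v‖⁻¹ • v, by simp [norm_smul, hv]⟩
    simp [hv, fourthMoment]

/-- The direction from `x` to itself is `0` by the convention `0⁻¹ = 0`, but `{x}` is a null set. -/
theorem ae_norm_direction_eq_one (hn : 1 ≤ n) :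
    ∀ᵐ y ∂(localMeasure volume x r), ‖direction x y‖ = 1 := by
  have : Nonempty (Fin n) := ⟨⟨0, hn⟩⟩
  refine cond_absolutelyContinuous.ae_le ?_
  have : ∀ᵐ y ∂(volume : Measure (E n)), y ≠ x := by simp [ae_iff]
  filter_upwards [this] with y hy
  rw [direction, norm_smul, norm_inv, norm_norm, inv_mul_cancel₀]
  simpa [sub_eq_zero] using hy

/-- The mixed moments of the components of a uniformly random direction along `v` and `w`, by
polarization of the fourth moment; the constant follows by summation over an orthonormal basis. -/
theorem integral_inner_sq_mul_inner_sq (hn : 1 ≤ n) (hr : 0 < r) (v w : E n) :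
    ∫ y, inner ℝ (direction x y) v ^ 2 * inner ℝ (direction x y) w ^ 2
        ∂(localMeasure volume x r) =
      (2 * inner ℝ v w ^ 2 + ‖v‖ ^ 2 * ‖w‖ ^ 2) / (n * (n + 2)) ∧
    ∫ y, inner ℝ (direction x y) v ^ 2 ∂(localMeasure volume x r) = ‖v‖ ^ 2 / n := by
  have := isProbabilityMeasure_localMeasure_volume x hr
  have hn' : (0 : ℝ) < n := by exact_mod_cast hn
  obtain ⟨c, hc⟩ := exists_fourthMoment_eq x r
  have hint (v w : E n) := integrable_inner_pow x (r := r) v w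
  have hint1 (v : E n) (k : ℕ) : Integrable (fun y => inner ℝ (direction x y) v ^ k)
      (localMeasure volume x r) := by simpa using hint v v k 0
  have hpol (v w : E n) : ∫ y, inner ℝ (direction x y) v ^ 2 * inner ℝ (direction x y) w ^ 2
      ∂(localMeasure volume x r) = c / 3 * (2 * inner ℝ v w ^ 2 + ‖v‖ ^ 2 * ‖w‖ ^ 2) := by
    -- `(s + t)⁴ + (s - t)⁴ = 2 s⁴ + 2 t⁴ + 12 s² t²`
    have h1 : fourthMoment x r (v + w) + fourthMoment x r (v - w) =
        2 * fourthMoment x r v + 2 * fourthMoment x r w + 12 * ∫ y, inner ℝ (direction x y) v ^ 2 *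
          inner ℝ (direction x y) w ^ 2 ∂(localMeasure volume x r) := by
      simp only [fourthMoment]
      rw [← integral_add (hint1 _ _) (hint1 _ _), ← integral_const_mul, ← integral_const_mul,
        ← integral_const_mul, ← integral_add ((hint1 _ _).const_mul _) ((hint1 _ _).const_mul _),
        ← integral_add (by exact ((hint1 _ _).const_mul _).add ((hint1 _ _).const_mul _))
          ((hint _ _ _ _).const_mul _)]
      refine integral_congr_ae (Filter.Eventually.of_forall fun y => ?_)
      simp only [inner_add_right, inner_sub_right]
      ring
    have h2 := norm_add_sq_real v w
    have h3 := norm_sub_sq_real v w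
    have h4 (z : E n) : ‖z‖ ^ 4 = (‖z‖ ^ 2) ^ 2 := by ring
    rw [hc, hc, hc, hc, h4 (v + w), h4 (v - w), h2, h3] at h1
    linear_combination (-1 / 12) * h1
  have hsum (v : E n) : ∑ i : Fin n, inner ℝ v (EuclideanSpace.single i (1 : ℝ)) ^ 2 = ‖v‖ ^ 2 := by
    simp [EuclideanSpace.inner_single_right, sum_sq_coord]
  have hone := ae_norm_direction_eq_one x (r := r) hn
  have htwo (v : E n) : ∫ y, inner ℝ (direction x y) v ^ 2 ∂(localMeasure volume x r) =
      c / 3 * (n + 2) * ‖v‖ ^ 2 := by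
    have h1 : ∫ y, inner ℝ (direction x y) v ^ 2 ∂(localMeasure volume x r) =
        ∑ i : Fin n, ∫ y, inner ℝ (direction x y) v ^ 2 *
          inner ℝ (direction x y) (EuclideanSpace.single i (1 : ℝ)) ^ 2
          ∂(localMeasure volume x r) := by
      rw [← integral_finsetSum _ fun i _ => hint _ _ _ _]
      refine integral_congr_ae ?_
      filter_upwards [hone] with y hy
      rw [← Finset.mul_sum, hsum, hy]
      ring
    rw [h1]
    simp only [hpol]
    rw [← Finset.mul_sum, Finset.sum_add_distrib, ← Finset.mul_sum, hsum]
    simp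
    ring
  have hcn : c / 3 * (n * (n + 2)) = 1 := by
    have h1 : (1 : ℝ) = ∑ i : Fin n, ∫ y,
        inner ℝ (direction x y) (EuclideanSpace.single i (1 : ℝ)) ^ 2
          ∂(localMeasure volume x r) := by
      rw [← integral_finsetSum _ fun i _ => hint1 _ _]
      have : ∀ᵐ y ∂(localMeasure volume x r), ∑ i : Fin n,
          inner ℝ (direction x y) (EuclideanSpace.single i (1 : ℝ)) ^ 2 = (1 : ℝ) := by
        filter_upwards [hone] with y hy
        rw [hsum, hy, one_pow]
      rw [integral_congr_ae this]
      simp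
    simp only [htwo] at h1
    simp at h1
    linarith
  have hc3 : c / 3 = 1 / (n * (n + 2)) := by
    field_simp
    field_simp at hcn
    linarith
  constructor
  · rw [hpol, hc3]
    ring
  · rw [htwo, hc3]
    field_simp

/-- A symmetric matrix is determined by its quadratic form. -/
theorem eq_of_quadratic_eq {A B : Mat n} (hA : ∀ i j, A i j = A j i) (hB : ∀ i j, B i j = B j i)
    (h : ∀ v : E n, ∑ i, ∑ j, v i * A i j * v j = ∑ i, ∑ j, v i * B i j * v j) : A = B := by
  have hs (T : Mat n) (i j : Fin n) (s t : ℝ) : ∑ k, ∑ l,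
      (EuclideanSpace.single i s + EuclideanSpace.single j t : E n) k * T k l *
        (EuclideanSpace.single i s + EuclideanSpace.single j t : E n) l =
      s * T i i * s + s * T i j * t + t * T j i * s + t * T j j * t := by
    simp only [PiLp.add_apply, PiLp.single_apply, add_mul, mul_add, ite_mul, mul_ite,
      zero_mul, mul_zero, Finset.sum_add_distrib, Finset.sum_ite_eq', Finset.mem_univ, if_true]
    ring
  ext i j
  have h1 := h (EuclideanSpace.single i 1 + EuclideanSpace.single j 1)
  have h2 := h (EuclideanSpace.single i 1 + EuclideanSpace.single j (-1))
  rw [hs, hs] at h1 h2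
  have := hA i j
  have := hB i j
  linarith

theorem hasExpectation_proj (μ : Measure (E n)) [IsProbabilityMeasure (localMeasure μ x r)] :
    HasExpectation (localMeasure μ x r) fun y => proj x y := by
  simp only [← outer_direction]
  exact hasExpectation_outer (MemLp.of_bound (measurable_direction x).aestronglyMeasurable 1
    (Filter.Eventually.of_forall fun y => norm_direction_le_one x y))

theorem hasExpectation_proj_outer_proj (μ : Measure (E n))
    [IsProbabilityMeasure (localMeasure μ x r)] (g : E n) :
    HasExpectation (localMeasure μ x r) fun y => proj x y * outer g * proj x y := by
  simp only [proj_mul_outer_mul_proj]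
  exact hasExpectation_outer (MemLp.of_bound (measurable_proj_apply x g).aestronglyMeasurable ‖g‖
    (Filter.Eventually.of_forall fun y => norm_proj_le x y g))

theorem quadratic_expectation {Ω : Type} [MeasurableSpace Ω] {P : Measure Ω} {A : Ω → Mat n}
    (hA : HasExpectation P A) (v : E n) :
    ∑ i, ∑ j, v i * expectation P A i j * v j = ∫ ω, ∑ i, ∑ j, v i * A ω i j * v j ∂P := by
  have hs (i j) : Integrable (fun ω => v i * A ω i j * v j) P := ((hA i j).const_mul _).mul_const _
  rw [integral_finsetSum _ fun i _ => integrable_finsetSum _ fun j _ => hs i j]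
  refine Finset.sum_congr rfl fun i _ => ?_
  rw [integral_finsetSum _ fun j _ => hs i j]
  refine Finset.sum_congr rfl fun j _ => ?_
  rw [integral_mul_const, integral_const_mul]
  rfl

theorem quadratic_outer (u v : E n) :
    ∑ i, ∑ j, v i * outer u i j * v j = inner ℝ u v ^ 2 := by
  simp only [PiLp.inner_apply, sq, Finset.sum_mul_sum, outer, Matrix.of_apply]
  refine Finset.sum_congr rfl fun i _ => Finset.sum_congr rfl fun j _ => ?_
  simp
  ring

theorem quadratic_one (v : E n) : ∑ i, ∑ j, v i * (1 : Mat n) i j * v j = ‖v‖ ^ 2 := by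
  rw [← sum_sq_coord]
  simp [Matrix.one_apply, sq]

theorem quadratic_add_smul (a b : ℝ) (A B : Mat n) (v : E n) :
    ∑ i, ∑ j, v i * (a • A + b • B) i j * v j =
      a * ∑ i, ∑ j, v i * A i j * v j + b * ∑ i, ∑ j, v i * B i j * v j := by
  simp only [Finset.mul_sum, ← Finset.sum_add_distrib]
  refine Finset.sum_congr rfl fun i _ => Finset.sum_congr rfl fun j _ => ?_
  simp
  ring

theorem expectation_proj_uniform (hn : 1 ≤ n) (hr : 0 < r) :
    expectation (localMeasure volume x r) (fun y => proj x y) = (1 / (n : ℝ)) • (1 : Mat n) := by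
  have := isProbabilityMeasure_localMeasure_volume x hr
  refine eq_of_quadratic_eq (fun i j => ?_) (fun i j => ?_) fun v => ?_
  · simp [expectation, proj, outer, mul_comm]
  · simp [Matrix.one_apply, eq_comm]
  · rw [quadratic_expectation (hasExpectation_proj x volume)]
    have h1 := quadratic_add_smul (1 / (n : ℝ)) 0 1 1 v
    rw [quadratic_one, zero_smul, add_zero] at h1
    rw [h1]
    simp only [← outer_direction, quadratic_outer]
    rw [(integral_inner_sq_mul_inner_sq x hn hr v v).2]
    ring

theorem expectation_proj_outer_proj_uniform (hn : 1 ≤ n) (hr : 0 < r) (g : E n) :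
    expectation (localMeasure volume x r) (fun y => proj x y * outer g * proj x y) =
      (2 / ((n : ℝ) * (n + 2))) • outer g + (‖g‖ ^ 2 / ((n : ℝ) * (n + 2))) • (1 : Mat n) := by
  have := isProbabilityMeasure_localMeasure_volume x hr
  refine eq_of_quadratic_eq (fun i j => ?_) (fun i j => ?_) fun v => ?_
  · simp only [expectation, proj_mul_outer_mul_proj]
    simp only [outer, Matrix.of_apply, mul_comm]
  · simp [Matrix.one_apply, outer, eq_comm, mul_comm (g i)]
  · rw [quadratic_expectation (hasExpectation_proj_outer_proj x volume g), quadratic_add_smul,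
      quadratic_one, quadratic_outer]
    simp only [proj_mul_outer_mul_proj, quadratic_outer, toEuclideanCLM_proj_eq,
      real_inner_smul_left, mul_pow]
    rw [(integral_inner_sq_mul_inner_sq x hn hr g v).1]
    ring

end

/-! ### The conditional bias given the number of neighbours -/

/-- The second moment of `n / k` times the sum of `k` independent copies of `a`. -/
noncomputable def gradSecondMoment {n : ℕ} (lam : Measure (E n)) (k : ℝ) (a : E n → E n) : Mat n :=
  (n : ℝ) ^ 2 • ((1 / k) • expectation lam (fun y => outer (a y)) +
    (1 - 1 / k) • outer (∫ y, a y ∂lam))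

section

variable {n : ℕ} {lam : Measure (E n)} [IsProbabilityMeasure lam] {a b : E n → E n} {G η k : ℝ}

theorem memLp_two_of_close (ha : AEStronglyMeasurable a lam) (hbG : ∀ y, ‖b y‖ ≤ G)
    (hab : ∀ᵐ y ∂lam, ‖a y - b y‖ ≤ η) : MemLp a 2 lam := by
  refine MemLp.of_bound ha (G + η) ?_
  filter_upwards [hab] with y hy
  calc ‖a y‖ = ‖b y + (a y - b y)‖ := by congr 1; abel
    _ ≤ _ := (norm_add_le _ _).trans (add_le_add (hbG y) hy)

theorem frobNorm_gradSecondMoment_sub_le (ha : AEStronglyMeasurable a lam)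
    (hb : AEStronglyMeasurable b lam) (hbG : ∀ y, ‖b y‖ ≤ G)
    (hab : ∀ᵐ y ∂lam, ‖a y - b y‖ ≤ η) (hk : 1 ≤ k) :
    frobNorm (gradSecondMoment lam k a - gradSecondMoment lam k b) ≤
      (n : ℝ) ^ 2 * (2 * (∫ y, ‖b y‖ ∂lam) * η + η ^ 2) := by
  have ha2 := memLp_two_of_close ha hbG hab
  have hb2 : MemLp b 2 lam := MemLp.of_bound hb G (Filter.Eventually.of_forall hbG)
  have hai := ha2.integrable one_le_two
  have hbi := hb2.integrable one_le_two
  have hab' : ‖(∫ y, a y ∂lam) - ∫ y, b y ∂lam‖ ≤ η := by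
    rw [← integral_sub hai hbi]
    simpa using norm_integral_le_of_norm_le_const hab
  have hbn : ‖∫ y, b y ∂lam‖ ≤ ∫ y, ‖b y‖ ∂lam := norm_integral_le_integral_norm _
  have h1 : frobNorm (expectation lam (fun y => outer (a y)) -
      expectation lam (fun y => outer (b y))) ≤ 2 * (∫ y, ‖b y‖ ∂lam) * η + η ^ 2 := by
    rw [← expectation_sub (hasExpectation_outer ha2) (hasExpectation_outer hb2)]
    refine (frobNorm_expectation_le ((hasExpectation_outer ha2).sub (hasExpectation_outer hb2))
      (h := fun y => 2 * ‖b y‖ * η + η ^ 2)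
      (((hbi.norm.const_mul 2).mul_const η).add (integrable_const _)) ?_).trans_eq ?_
    · filter_upwards [hab] with y hy
      refine (frobNorm_outer_sub_outer_le _ _).trans ?_
      gcongr
    · rw [integral_add ((hbi.norm.const_mul 2).mul_const η) (integrable_const _),
        integral_mul_const, integral_const_mul]
      simp
  have h2 : frobNorm (outer (∫ y, a y ∂lam) - outer (∫ y, b y ∂lam)) ≤
      2 * (∫ y, ‖b y‖ ∂lam) * η + η ^ 2 := by
    refine (frobNorm_outer_sub_outer_le _ _).trans ?_
    gcongr
  have hk0 : 0 ≤ 1 / k := by positivity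
  have hk1 : 0 ≤ 1 - 1 / k := by
    rw [sub_nonneg, div_le_one (by linarith)]
    exact hk
  have h3 : gradSecondMoment lam k a - gradSecondMoment lam k b = (n : ℝ) ^ 2 •
      ((1 / k) • (expectation lam (fun y => outer (a y)) -
        expectation lam (fun y => outer (b y))) +
      (1 - 1 / k) • (outer (∫ y, a y ∂lam) - outer (∫ y, b y ∂lam))) := by
    simp only [gradSecondMoment, ← smul_sub]
    congr 1
    simp only [smul_sub]
    abel
  rw [h3, frobNorm_smul, abs_of_nonneg (by positivity)]
  gcongr
  refine (frobNorm_add_le _ _).trans ?_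
  rw [frobNorm_smul, frobNorm_smul, abs_of_nonneg hk0, abs_of_nonneg hk1]
  calc _ ≤ (1 / k) * (2 * (∫ y, ‖b y‖ ∂lam) * η + η ^ 2) +
        (1 - 1 / k) * (2 * (∫ y, ‖b y‖ ∂lam) * η + η ^ 2) := by gcongr
    _ = _ := by ring

theorem integral_proj_apply {x : E n} {g : E n} (hP : HasExpectation lam fun y => proj x y) :
    ∫ y, Matrix.toEuclideanCLM (𝕜 := ℝ) (proj x y) g ∂lam =
      Matrix.toEuclideanCLM (𝕜 := ℝ) (expectation lam fun y => proj x y) g := by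
  ext i
  rw [integral_apply, toEuclideanCLM_apply]
  · simp only [toEuclideanCLM_apply]
    have hs (j) : Integrable (fun y => proj x y i j * g j) lam := (hP i j).mul_const _
    rw [integral_finsetSum _ fun j _ => hs j]
    refine Finset.sum_congr rfl fun j _ => ?_
    rw [integral_mul_const]
    rfl
  · exact Integrable.of_bound (measurable_proj_apply x g).aestronglyMeasurable ‖g‖
      (Filter.Eventually.of_forall fun y => norm_proj_le x y g)

/-- The deviation of the first two moments of the random projection `P_{x,y}` from isotropy, at
most `β₁` and `β₂`, bounds the deviation of the second moment of the gradient estimate. -/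
theorem frobNorm_gradSecondMoment_sub_isotropicMoment_le (hn : 1 ≤ n) {x g : E n} {β₁ β₂ : ℝ}
    (hP : HasExpectation lam fun y => proj x y) (hk : 1 ≤ k)
    (h₁ : n * specNorm (expectation lam (fun y => proj x y) - (1 / (n : ℝ)) • (1 : Mat n)) ≤ β₁)
    (h₂ : (n : ℝ) ^ 2 * frobNorm (expectation lam (fun y => proj x y * outer g * proj x y) -
      ((2 / ((n : ℝ) * (n + 2))) • outer g + (‖g‖ ^ 2 / ((n : ℝ) * (n + 2))) • (1 : Mat n))) ≤
        β₂) :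
    frobNorm (gradSecondMoment lam k (fun y => Matrix.toEuclideanCLM (𝕜 := ℝ) (proj x y) g) -
      isotropicMoment k g) ≤ β₂ / k + (2 * β₁ + β₁ ^ 2) * ‖g‖ ^ 2 := by
  have hn' : (0 : ℝ) < n := by exact_mod_cast hn
  have hk' : 0 < k := by linarith
  have hk1 : 1 / k ≤ 1 := by rw [div_le_one hk']; exact hk
  have hk0 : 0 ≤ 1 / k := by positivity
  have hβ₁ : 0 ≤ β₁ := le_trans (mul_nonneg hn'.le (norm_nonneg _)) h₁
  set p := ∫ y, Matrix.toEuclideanCLM (𝕜 := ℝ) (proj x y) g ∂lam with hp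
  have hs : ‖(n : ℝ) • p - g‖ ≤ β₁ * ‖g‖ := by
    have : (n : ℝ) • p - g = (n : ℝ) • Matrix.toEuclideanCLM (𝕜 := ℝ)
        (expectation lam (fun y => proj x y) - (1 / (n : ℝ)) • (1 : Mat n)) g := by
      rw [hp, integral_proj_apply hP, map_sub, map_smul, map_one]
      simp [smul_sub, smul_smul, hn'.ne']
    rw [this, norm_smul, Real.norm_of_nonneg hn'.le]
    calc _ ≤ n * (specNorm (expectation lam (fun y => proj x y) - (1 / (n : ℝ)) • (1 : Mat n)) *
          ‖g‖) := by
          gcongr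
          exact ContinuousLinearMap.le_opNorm _ _
      _ ≤ _ := by
          rw [← mul_assoc]
          gcongr
  have hnp : (n : ℝ) ^ 2 • outer p = outer ((n : ℝ) • p) := by
    ext i j
    simp [outer]
    ring
  have hdec : gradSecondMoment lam k (fun y => Matrix.toEuclideanCLM (𝕜 := ℝ) (proj x y) g) -
      isotropicMoment k g =
      (1 / k) • ((n : ℝ) ^ 2 • (expectation lam (fun y => proj x y * outer g * proj x y) -
        ((2 / ((n : ℝ) * (n + 2))) • outer g + (‖g‖ ^ 2 / ((n : ℝ) * (n + 2))) • (1 : Mat n)))) +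
      (1 - 1 / k) • (outer ((n : ℝ) • p) - outer g) := by
    rw [← hnp]
    simp only [gradSecondMoment, isotropicMoment, ← hp, proj_mul_outer_mul_proj]
    ext i j
    simp only [Matrix.sub_apply, Matrix.add_apply, Matrix.smul_apply, smul_eq_mul]
    field_simp
    ring
  rw [hdec]
  refine (frobNorm_add_le _ _).trans (add_le_add ?_ ?_)
  · rw [frobNorm_smul, frobNorm_smul, abs_of_nonneg hk0, abs_of_nonneg (by positivity),
      div_mul_eq_mul_div, one_mul]
    gcongr
  · rw [frobNorm_smul, abs_of_nonneg (by linarith)]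
    have h4 := frobNorm_outer_sub_outer_le ((n : ℝ) • p) g
    have h5 : 2 * ‖g‖ * ‖(n : ℝ) • p - g‖ + ‖(n : ℝ) • p - g‖ ^ 2 ≤
        2 * ‖g‖ * (β₁ * ‖g‖) + (β₁ * ‖g‖) ^ 2 := by gcongr
    calc _ ≤ 1 * frobNorm (outer ((n : ℝ) • p) - outer g) := by
          gcongr
          · exact frobNorm_nonneg _
          · linarith
      _ ≤ _ := by rw [one_mul]; linarith

/-- The bias of the debiased gradient outer product when the sample points with index in `S` are
the neighbours of `x`. -/
theorem frobNorm_expectation_debias_sub_le {M m : ℕ} (hn : 1 ≤ n) {Q : Fin M → Measure (E n)}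
    [∀ k, IsProbabilityMeasure (Q k)] {S : Finset (Fin M)} (hS : ∀ k ∈ S, Q k = lam)
    (hm : 1 ≤ m) (hmS : m ≤ S.card) {x g : E n} {β₁ β₂ q : ℝ}
    (ha : AEStronglyMeasurable a lam) (hη : 0 ≤ η)
    (hab : ∀ᵐ y ∂lam, ‖a y - Matrix.toEuclideanCLM (𝕜 := ℝ) (proj x y) g‖ ≤ η)
    (hq : ∫ y, ‖Matrix.toEuclideanCLM (𝕜 := ℝ) (proj x y) g‖ ∂lam ≤ q)
    (hP : HasExpectation lam fun y => proj x y)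
    (h₁ : n * specNorm (expectation lam (fun y => proj x y) - (1 / (n : ℝ)) • (1 : Mat n)) ≤ β₁)
    (h₂ : (n : ℝ) ^ 2 * frobNorm (expectation lam (fun y => proj x y * outer g * proj x y) -
      ((2 / ((n : ℝ) * (n + 2))) • outer g + (‖g‖ ^ 2 / ((n : ℝ) * (n + 2))) • (1 : Mat n))) ≤
        β₂) :
    HasExpectation (Measure.pi Q) (fun Y => debias (scale n m) (traceDenom n m)
      (outer (((n : ℝ) / S.card) • ∑ k ∈ S, a (Y k)))) ∧
    frobNorm (expectation (Measure.pi Q) (fun Y => debias (scale n m) (traceDenom n m)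
      (outer (((n : ℝ) / S.card) • ∑ k ∈ S, a (Y k)))) - outer g) ≤
      3 * ((n : ℝ) ^ 2 * (2 * q * η + η ^ 2) + β₂ / S.card + (2 * β₁ + β₁ ^ 2) * ‖g‖ ^ 2 +
        (1 / (m : ℝ) - 1 / S.card) * (3 * ‖g‖ ^ 2 * (1 + Real.sqrt n))) := by
  have hm' : (1 : ℝ) ≤ m := by exact_mod_cast hm
  have hmS' : (m : ℝ) ≤ S.card := by exact_mod_cast hmS
  have hk1 : (1 : ℝ) ≤ S.card := hm'.trans hmS'
  have hk0 : (0 : ℝ) < S.card := by linarith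
  have ha2 := memLp_two_of_close ha (fun y => norm_proj_le x y g) hab
  obtain ⟨hex, heq⟩ := expectation_outer_sum hS ha2
  have hsm (Y : Fin M → E n) : outer (((n : ℝ) / S.card) • ∑ k ∈ S, a (Y k)) =
      ((n : ℝ) / S.card) ^ 2 • outer (∑ k ∈ S, a (Y k)) := by
    ext i j
    simp only [outer, Matrix.of_apply, Matrix.smul_apply, PiLp.smul_apply, smul_eq_mul]
    ring
  have hex' : HasExpectation (Measure.pi Q)
      (fun Y => outer (((n : ℝ) / S.card) • ∑ k ∈ S, a (Y k))) := by
    simp only [hsm]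
    exact hex.smul _
  have heq' : expectation (Measure.pi Q)
      (fun Y => outer (((n : ℝ) / S.card) • ∑ k ∈ S, a (Y k))) =
      gradSecondMoment lam S.card a := by
    simp only [hsm]
    rw [expectation_smul, heq, gradSecondMoment]
    ext i j
    simp only [Matrix.add_apply, Matrix.smul_apply, smul_eq_mul]
    field_simp
  refine ⟨hex'.debias _ _, ?_⟩
  rw [expectation_debias _ _ hex', heq']
  have hW : gradSecondMoment lam S.card a = isotropicMoment m g +
      ((gradSecondMoment lam S.card a - gradSecondMoment lam S.card
          fun y => Matrix.toEuclideanCLM (𝕜 := ℝ) (proj x y) g) +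
        (gradSecondMoment lam S.card
          (fun y => Matrix.toEuclideanCLM (𝕜 := ℝ) (proj x y) g) - isotropicMoment S.card g) +
        (isotropicMoment S.card g - isotropicMoment m g)) := by abel
  rw [hW, debias_add, debias_isotropicMoment hn hm', add_sub_cancel_left]
  refine (frobNorm_debias_le hn (two_thirds_le_scale hn hm') (le_traceDenom hm') _).trans ?_
  gcongr
  refine (frobNorm_add_le _ _).trans ?_
  refine (add_le_add (frobNorm_add_le _ _) le_rfl).trans ?_
  have e1 := frobNorm_gradSecondMoment_sub_le ha
    (measurable_proj_apply x g).aestronglyMeasurable (fun y => norm_proj_le x y g) hab hk1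
  have e2 := frobNorm_gradSecondMoment_sub_isotropicMoment_le hn hP hk1 h₁ h₂
  have e3 := frobNorm_isotropicMoment_sub_le hm' hmS' g
  have e4 : (n : ℝ) ^ 2 * (2 * (∫ y, ‖Matrix.toEuclideanCLM (𝕜 := ℝ) (proj x y) g‖ ∂lam) * η +
      η ^ 2) ≤ (n : ℝ) ^ 2 * (2 * q * η + η ^ 2) := by gcongr
  linarith

end

/-! ### Cells of the sample space -/

section

variable {n N M : ℕ} {X : Fin N → E n} {D : Set (E n)} {r : ℝ} {μ : Measure (E n)}

/-- Every number below `r ≤ ε_X` is less than some admissible radius. -/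
theorem exists_radius_gt (hr : 0 < r) (hX : ENNReal.ofReal r ≤ separationRadius D X) {s : ℝ}
    (hs : s < r) : ∃ t, s < t ∧ (∀ i, X i ∈ interiorPts D t) ∧
      ∀ i j, X i ≠ X j → 2 * t ≤ ‖X i - X j‖ := by
  have h1 : ENNReal.ofReal s < separationRadius D X :=
    ((ENNReal.ofReal_lt_ofReal_iff hr).2 hs).trans_le hX
  obtain ⟨_, ⟨t, ht, rfl⟩, hst⟩ := lt_sSup_iff.1 h1
  exact ⟨t, (ENNReal.ofReal_lt_ofReal_iff'.1 hst).1, ht⟩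

theorem two_mul_le_of_le_separationRadius (hr : 0 < r)
    (hX : ENNReal.ofReal r ≤ separationRadius D X) {i j : Fin N} (hij : X i ≠ X j) :
    2 * r ≤ ‖X i - X j‖ := by
  by_contra! h
  obtain ⟨t, ht, -, h2⟩ := exists_radius_gt hr hX (s := ‖X i - X j‖ / 2) (by linarith)
  linarith [h2 i j hij]

theorem mem_interiorPts_of_le_separationRadius (hr : 0 < r)
    (hX : ENNReal.ofReal r ≤ separationRadius D X) (i : Fin N) : X i ∈ interiorPts D r := by
  obtain ⟨_, -, h1, -⟩ := exists_radius_gt hr hX (s := 0) hr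
  refine ⟨(h1 i).1, fun y hy => ?_⟩
  obtain ⟨t, ht, h1, -⟩ := exists_radius_gt hr hX (Metric.mem_ball.1 hy)
  exact (h1 i).2 ht

/-- The event that the sample point with index `k` lies in the ball about `σ k`. The labels are the
points of `X` rather than their indices, since `X` may have repetitions. -/
def cell (r : ℝ) (σ : Fin M → Set.range X) : Set (Fin M → E n) :=
  Set.pi Set.univ fun k => Metric.ball (σ k : E n) r

theorem measurableSet_cell (σ : Fin M → Set.range X) : MeasurableSet (cell r σ) :=
  MeasurableSet.univ_pi fun _ => Metric.isOpen_ball.measurableSet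

theorem mem_ball_iff_of_mem_cell (hsep : ∀ i j, X i ≠ X j → 2 * r ≤ ‖X i - X j‖)
    {σ : Fin M → Set.range X} {Y : Fin M → E n} (hY : Y ∈ cell r σ) (i : Fin N) (k : Fin M) :
    Y k ∈ Metric.ball (X i) r ↔ (σ k : E n) = X i := by
  have hk : Y k ∈ Metric.ball (σ k : E n) r := hY k trivial
  constructor
  · intro h
    obtain ⟨j, hj⟩ := (σ k).2
    by_contra hne
    rw [← hj] at hne hk
    have h1 := hsep j i hne
    have h2 := dist_triangle_left (X j) (X i) (Y k)
    rw [Metric.mem_ball] at h hk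
    rw [dist_eq_norm (X j) (X i)] at h2
    linarith
  · intro h
    rwa [← h]

theorem pairwise_disjoint_cell (hsep : ∀ i j, X i ≠ X j → 2 * r ≤ ‖X i - X j‖) :
    Pairwise (Function.onFun Disjoint (cell (X := X) (M := M) r)) := by
  intro σ τ hne
  refine Set.disjoint_left.2 fun Y hσ hτ => hne ?_
  ext1 k
  obtain ⟨i, hi⟩ := (τ k).2
  have h1 := (mem_ball_iff_of_mem_cell hsep hτ i k).2 hi.symm
  exact Subtype.ext (((mem_ball_iff_of_mem_cell hsep hσ i k).1 h1).trans hi)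

open Classical in
/-- The indices of the sample points that the labelling `σ` assigns to `x`. -/
noncomputable def labelled (σ : Fin M → Set.range X) (x : E n) : Finset (Fin M) :=
  Finset.univ.filter fun k => (σ k : E n) = x

theorem neighbors_eq_labelled (hsep : ∀ i j, X i ≠ X j → 2 * r ≤ ‖X i - X j‖)
    {σ : Fin M → Set.range X} {Y : Fin M → E n} (hY : Y ∈ cell r σ) (i : Fin N) :
    neighbors r Y (X i) = labelled σ (X i) := by
  ext k
  simp only [neighbors, labelled, Finset.mem_filter, Finset.mem_univ, true_and]
  exact mem_ball_iff_of_mem_cell hsep hY i k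

theorem measurableSet_ballUnion : MeasurableSet (ballUnion X r) :=
  (isOpen_iUnion fun _ => Metric.isOpen_ball).measurableSet

theorem ball_subset_ballUnion (i : Fin N) : Metric.ball (X i) r ⊆ ballUnion X r :=
  Set.subset_iUnion (fun i => Metric.ball (X i) r) i

theorem cond_ballUnion_ball [IsFiniteMeasure μ] (i : Fin N) :
    ProbabilityTheory.cond (ProbabilityTheory.cond μ (ballUnion X r)) (Metric.ball (X i) r) =
      localMeasure μ (X i) r := by
  rw [cond_cond_eq_cond_inter measurableSet_ballUnion Metric.isOpen_ball.measurableSet,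
    Set.inter_eq_self_of_subset_right (ball_subset_ballUnion i)]
  rfl

/-- Given the labels, the sample points are independent, and each of them follows the conditional
measure of its ball. -/
theorem cond_sampleLaw_cell [IsFiniteMeasure μ]
    [IsProbabilityMeasure (ProbabilityTheory.cond μ (ballUnion X r))] {σ : Fin M → Set.range X}
    (h : sampleLaw μ X r M (cell r σ) ≠ 0) :
    (∀ k, IsProbabilityMeasure (localMeasure μ (σ k : E n) r)) ∧
    ProbabilityTheory.cond (sampleLaw μ X r M) (cell r σ) =
      Measure.pi fun k => localMeasure μ (σ k : E n) r := by
  rw [sampleLaw, cell, Measure.pi_pi, Finset.prod_ne_zero_iff] at h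
  have hk (k : Fin M) : ProbabilityTheory.cond (ProbabilityTheory.cond μ (ballUnion X r))
      (Metric.ball (σ k : E n) r) = localMeasure μ (σ k : E n) r := by
    obtain ⟨i, hi⟩ := (σ k).2
    rw [← hi]
    exact cond_ballUnion_ball i
  refine ⟨fun k => ?_, ?_⟩
  · rw [← hk]
    exact cond_isProbabilityMeasure (h k (Finset.mem_univ k))
  · rw [sampleLaw, cell, cond_pi _ (fun _ => Metric.isOpen_ball.measurableSet)
      fun k => h k (Finset.mem_univ k)]
    simp only [hk]

theorem ae_exists_mem_cell [IsProbabilityMeasure (ProbabilityTheory.cond μ (ballUnion X r))] :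
    ∀ᵐ Y ∂(sampleLaw μ X r M), ∃ σ : Fin M → Set.range X, Y ∈ cell r σ := by
  have h1 : ∀ k : Fin M, ∀ᵐ Y ∂(sampleLaw μ X r M), Y k ∈ ballUnion X r := fun k =>
    (Measure.quasiMeasurePreserving_eval
      (fun _ : Fin M => ProbabilityTheory.cond μ (ballUnion X r)) k).ae
      (ae_cond_mem measurableSet_ballUnion)
  filter_upwards [ae_all_iff.2 h1] with Y hY
  choose i hi using fun k => Set.mem_iUnion.1 (hY k)
  exact ⟨fun k => ⟨X (i k), i k, rfl⟩, fun k _ => hi k⟩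

/-! ### The bias of one summand of the estimator -/

/-- The summand of the estimator that belongs to the point `X i`. -/
noncomputable def summand (f : E n → ℝ) (r : ℝ) (m : ℕ) (X : Fin N → E n) (i : Fin N)
    (Y : Fin M → E n) : Mat n :=
  if m ≤ numNeighbors r Y (X i) then
    debias (scale n m) (traceDenom n m) (outer (gradEst f r Y (X i))) else 0

theorem estimator_eq_sum_summand (f : E n → ℝ) (m : ℕ) (Y : Fin M → E n) :
    estimator f r m X Y = (1 / (N : ℝ)) • ∑ i, summand f r m X i Y := by
  simp only [estimator, summand, ← Finset.sum_filter, debias, ← Finset.smul_sum, trace_outer]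
  rw [mul_smul]
  rfl

/-- The bias of a summand under a law `P` that gives the sample points with prescribed labels their
product law. The bound `τ` covers the cells with more than `m` neighbours of `X i`; on the cells
with fewer than `m` the summand is `0`, and its error is at most `L ^ 2`. -/
theorem frobNorm_expectation_summand_sub_le {m : ℕ} {f : E n → ℝ} (hn : 1 ≤ n) (hm : 1 ≤ m)
    (hr : 0 < r) (hD : IsOpen D) (hf : IsSmooth D f)
    (hX : ENNReal.ofReal r ≤ separationRadius D X) {P : Measure (Fin M → E n)}
    [IsProbabilityMeasure P]
    (hcover : ∀ᵐ Y ∂P, ∃ σ : Fin M → Set.range X, Y ∈ cell r σ)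
    (hcond : ∀ σ : Fin M → Set.range X, P (cell r σ) ≠ 0 →
      (∀ k, IsProbabilityMeasure (localMeasure μ (σ k : E n) r)) ∧
      ProbabilityTheory.cond P (cell r σ) = Measure.pi fun k => localMeasure μ (σ k : E n) r)
    (i : Fin N) [IsProbabilityMeasure (localMeasure μ (X i) r)] {β₁ β₂ q L τ : ℝ}
    (hL : ‖gradient f (X i)‖ ≤ L)
    (hq : ∫ y, ‖Matrix.toEuclideanCLM (𝕜 := ℝ) (proj (X i) y) (gradient f (X i))‖
      ∂(localMeasure μ (X i) r) ≤ q)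
    (h₁ : n * specNorm (expectation (localMeasure μ (X i) r) (fun y => proj (X i) y) -
      (1 / (n : ℝ)) • (1 : Mat n)) ≤ β₁)
    (h₂ : (n : ℝ) ^ 2 * frobNorm (expectation (localMeasure μ (X i) r)
        (fun y => proj (X i) y * outer (gradient f (X i)) * proj (X i) y) -
      ((2 / ((n : ℝ) * (n + 2))) • outer (gradient f (X i)) +
        (‖gradient f (X i)‖ ^ 2 / ((n : ℝ) * (n + 2))) • (1 : Mat n))) ≤ β₂)
    (hτ : ∀ σ : Fin M → Set.range X, P (cell r σ) ≠ 0 → m ≤ (labelled σ (X i)).card →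
      (1 / (m : ℝ) - 1 / (labelled σ (X i)).card) *
        (3 * ‖gradient f (X i)‖ ^ 2 * (1 + Real.sqrt n)) ≤ τ)
    (hτ0 : 0 ≤ τ) :
    HasExpectation P (summand f r m X i) ∧
    frobNorm (expectation P (summand f r m X i) - outer (gradient f (X i))) ≤
      3 * ((n : ℝ) ^ 2 * (2 * q * (hessBound D f * r) + (hessBound D f * r) ^ 2) + β₂ / m +
        (2 * β₁ + β₁ ^ 2) * L ^ 2 + τ) +
      L ^ 2 * P.real {Y | numNeighbors r Y (X i) < m} := by
  classical
  have hsep : ∀ i j, X i ≠ X j → 2 * r ≤ ‖X i - X j‖ := fun i j hij =>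
    two_mul_le_of_le_separationRadius hr hX hij
  have hxi := mem_interiorPts_of_le_separationRadius hr hX i
  have hη : 0 ≤ hessBound D f * r := mul_nonneg (hessBound_nonneg D f) hr.le
  have hq0 : 0 ≤ q := (integral_nonneg fun _ => norm_nonneg _).trans hq
  have hβ₁ : 0 ≤ β₁ := le_trans (mul_nonneg n.cast_nonneg (norm_nonneg _)) h₁
  have hβ₂ : 0 ≤ β₂ := le_trans (mul_nonneg (sq_nonneg _) (frobNorm_nonneg _)) h₂
  have hm0 : (0 : ℝ) < m := by exact_mod_cast hm
  set x := X i with hx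
  set g := gradient f x with hg
  set b : ℝ := 3 * ((n : ℝ) ^ 2 * (2 * q * (hessBound D f * r) + (hessBound D f * r) ^ 2) +
    β₂ / m + (2 * β₁ + β₁ ^ 2) * L ^ 2 + τ) with hb
  have hb0 : 0 ≤ b := by positivity
  have hproj := hasExpectation_proj (r := r) x μ
  have hcell : ∀ σ : Fin M → Set.range X, P (cell r σ) ≠ 0 →
      HasExpectation (ProbabilityTheory.cond P (cell r σ)) (summand f r m X i) ∧
      frobNorm (expectation (ProbabilityTheory.cond P (cell r σ)) (summand f r m X i) - outer g) ≤
        if m ≤ (labelled σ x).card then b else L ^ 2 := by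
    intro σ hσ
    obtain ⟨hprob, hc⟩ := hcond σ hσ
    have hmem : ∀ᵐ Y ∂(ProbabilityTheory.cond P (cell r σ)), Y ∈ cell r σ :=
      ae_cond_mem (measurableSet_cell σ)
    split_ifs with hcard
    · have hae : (fun Y : Fin M → E n => debias (scale n m) (traceDenom n m)
          (outer (((n : ℝ) / (labelled σ x).card) • ∑ k ∈ labelled σ x, dirDiff f x (Y k))))
          =ᵐ[ProbabilityTheory.cond P (cell r σ)] summand f r m X i := by
        filter_upwards [hmem] with Y hY
        rw [summand, numNeighbors, gradEst_eq, ← hx,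
          neighbors_eq_labelled hsep hY i, if_pos hcard]
      have hS : ∀ k ∈ labelled σ x, localMeasure μ (σ k : E n) r = localMeasure μ x r := by
        intro k hk
        rw [(Finset.mem_filter.1 hk).2]
      have hab : ∀ᵐ y ∂(localMeasure μ x r), ‖dirDiff f x y -
          Matrix.toEuclideanCLM (𝕜 := ℝ) (proj x y) g‖ ≤ hessBound D f * r := by
        filter_upwards [ae_cond_mem Metric.isOpen_ball.measurableSet] with y hy
          using norm_dirDiff_sub_proj_le hD hf hxi.2 hy
      obtain ⟨hE, hB⟩ := frobNorm_expectation_debias_sub_le hn hS hm hcard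
        (aestronglyMeasurable_dirDiff hf μ hxi.2) hη hab hq hproj h₁ h₂
      rw [← hc] at hE hB
      refine ⟨hE.congr hae, ?_⟩
      rw [← expectation_congr hae]
      refine hB.trans ?_
      rw [hb]
      gcongr
      exact hτ σ hσ hcard
    · have hae : (fun _ : Fin M → E n => (0 : Mat n))
          =ᵐ[ProbabilityTheory.cond P (cell r σ)] summand f r m X i := by
        filter_upwards [hmem] with Y hY
        rw [summand, numNeighbors, ← hx, neighbors_eq_labelled hsep hY i, if_neg hcard]
      have : IsProbabilityMeasure (ProbabilityTheory.cond P (cell r σ)) :=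
        cond_isProbabilityMeasure hσ
      refine ⟨(hasExpectation_const _).congr hae, ?_⟩
      rw [← expectation_congr hae, expectation_const, zero_sub, ← neg_one_smul ℝ, frobNorm_smul,
        frobNorm_outer]
      simp only [abs_neg, abs_one, one_mul]
      gcongr
  refine ⟨hasExpectation_of_partition hcover fun σ hσ => (hcell σ hσ).1, ?_⟩
  have hdisj := pairwise_disjoint_cell (M := M) hsep
  refine (frobNorm_expectation_sub_le_of_partition measurableSet_cell hdisj hcover
    (fun σ hσ => (hcell σ hσ).1) _ fun σ hσ => (hcell σ hσ).2).trans ?_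
  have hle (σ : Fin M → Set.range X) : P.real (cell r σ) *
      (if m ≤ (labelled σ x).card then b else L ^ 2) ≤
      P.real (cell r σ) * b + L ^ 2 * if (labelled σ x).card < m then P.real (cell r σ) else 0 := by
    have h0 : 0 ≤ P.real (cell r σ) := measureReal_nonneg
    split_ifs with h h' h'
    · omega
    · simp
    · nlinarith [mul_nonneg h0 hb0]
    · omega
  refine (Finset.sum_le_sum fun σ _ => hle σ).trans ?_
  rw [Finset.sum_add_distrib, ← Finset.sum_mul,
    sum_measureReal_partition measurableSet_cell hdisj hcover, one_mul, ← Finset.mul_sum,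
    ← Finset.sum_filter]
  gcongr
  rw [← measureReal_biUnion_finset (fun σ _ τ _ h => hdisj h) fun σ _ => measurableSet_cell σ]
  refine measureReal_mono fun Y hY => ?_
  simp only [Set.mem_iUnion, Finset.mem_filter] at hY
  obtain ⟨σ, ⟨-, h⟩, hY⟩ := hY
  rw [Set.mem_ofPred_eq, numNeighbors, neighbors_eq_labelled hsep hY i]
  exact h

/-- Averaging a bound for the bias of the summands. -/
theorem frobNorm_expectation_estimator_sub_le {m : ℕ} {f : E n → ℝ} (hN : 1 ≤ N)
    {P : Measure (Fin M → E n)} {b : ℝ}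
    (h : ∀ i, HasExpectation P (summand f r m X i) ∧
      frobNorm (expectation P (summand f r m X i) - outer (gradient f (X i))) ≤ b) :
    HasExpectation P (fun Y => estimator f r m X Y) ∧
    frobNorm (expectation P (fun Y => estimator f r m X Y) - empirical f X) ≤ b := by
  have hN' : (0 : ℝ) < N := by exact_mod_cast hN
  simp only [estimator_eq_sum_summand]
  have hs : HasExpectation P fun Y => ∑ i, summand f r m X i Y :=
    HasExpectation.sum fun i _ => (h i).1
  refine ⟨hs.smul _, ?_⟩
  rw [expectation_smul, expectation_sum fun i _ => (h i).1, empirical, ← smul_sub,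
    ← Finset.sum_sub_distrib, frobNorm_smul, abs_of_pos (by positivity)]
  calc _ ≤ 1 / (N : ℝ) * ∑ _i : Fin N, b := by
        gcongr
        exact (frobNorm_sum_le _ _).trans (Finset.sum_le_sum fun i _ => (h i).2)
    _ = b := by
        rw [Finset.sum_const, Finset.card_univ, Fintype.card_fin, nsmul_eq_mul]
        field_simp

/-- By Chebyshev's inequality, it is unlikely that a ball contains less than half of the expected
number of sample points. -/
theorem measureReal_numNeighbors_lt_le {m : ℕ} (hm : 1 ≤ m)
    [IsProbabilityMeasure (ProbabilityTheory.cond μ (ballUnion X r))] (i : Fin N)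
    (h : 2 * (m : ℝ) ≤ M * (ProbabilityTheory.cond μ (ballUnion X r)).real
      (Metric.ball (X i) r)) :
    (sampleLaw μ X r M).real {Y | numNeighbors r Y (X i) < m} ≤ 2 / m := by
  classical
  set ν := ProbabilityTheory.cond μ (ballUnion X r) with hν
  set p := ν.real (Metric.ball (X i) r) with hp
  have hm0 : (0 : ℝ) < m := by exact_mod_cast hm
  set u : E n → ℝ := (Metric.ball (X i) r).indicator 1 with hu
  have hball : MeasurableSet (Metric.ball (X i) r) := Metric.isOpen_ball.measurableSet
  have hu2 : MemLp u 2 ν := memLp_indicator_const 2 hball 1 (Or.inr (measure_ne_top _ _))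
  have hint : ∫ y, u y ∂ν = p := by rw [hu, integral_indicator_one hball]
  have hvar : variance u ν ≤ p := by
    refine (variance_le_expectation_sq hu2.aestronglyMeasurable).trans_eq ?_
    rw [← hint]
    congr 1
    ext y
    simp only [Pi.pow_apply, hu, Set.indicator_apply]
    split_ifs <;> simp
  set Z : (Fin M → E n) → ℝ := ∑ k, fun Y => u (Y k) with hZ
  have hZn (Y : Fin M → E n) : Z Y = numNeighbors r Y (X i) := by
    simp only [hZ, Finset.sum_apply, hu, Set.indicator_apply, Pi.one_apply, Finset.sum_boole,
      numNeighbors, neighbors]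
  have hk2 (k : Fin M) : MemLp (fun Y : Fin M → E n => u (Y k)) 2 (sampleLaw μ X r M) :=
    hu2.comp_measurePreserving (measurePreserving_eval (fun _ : Fin M => ν) k)
  have hZ2 : MemLp Z 2 (sampleLaw μ X r M) := memLp_finsetSum' _ fun k _ => hk2 k
  have : IsProbabilityMeasure (sampleLaw μ X r M) := by rw [sampleLaw]; infer_instance
  have hZe : ∫ Y, Z Y ∂(sampleLaw μ X r M) = M * p := by
    simp only [hZ, Finset.sum_apply]
    rw [integral_finsetSum _ fun k _ => (hk2 k).integrable one_le_two]
    have (k : Fin M) : ∫ Y, u (Y k) ∂(sampleLaw μ X r M) = p := by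
      rw [sampleLaw, integral_comp_eval (μ := fun _ : Fin M => ν) (i := k) (f := u)
        hu2.aestronglyMeasurable, hint]
    simp [this]
  have hZv : variance Z (sampleLaw μ X r M) ≤ M * p := by
    rw [hZ, sampleLaw, variance_sum_pi (μ := fun _ : Fin M => ν) (X := fun _ => u) fun _ => hu2]
    simpa using mul_le_mul_of_nonneg_left hvar (Nat.cast_nonneg M)
  have hMp : 0 < M * p := by linarith
  have hcheb := meas_ge_le_variance_div_sq hZ2 (c := M * p / 2) (by positivity)
  rw [hZe] at hcheb
  have hsub : {Y : Fin M → E n | numNeighbors r Y (X i) < m} ⊆ {Y | M * p / 2 ≤ |Z Y - M * p|} := by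
    intro Y hY
    have h1 : (numNeighbors r Y (X i) : ℝ) < m := by exact_mod_cast hY
    rw [Set.mem_ofPred_eq, hZn, abs_sub_comm]
    exact le_trans (by linarith) (le_abs_self _)
  have h3 : (sampleLaw μ X r M).real {Y | M * p / 2 ≤ |Z Y - M * p|} ≤
      variance Z (sampleLaw μ X r M) / (M * p / 2) ^ 2 :=
    ENNReal.toReal_le_of_le_ofReal (div_nonneg (variance_nonneg _ _) (sq_nonneg _)) hcheb
  calc _ ≤ (sampleLaw μ X r M).real {Y | M * p / 2 ≤ |Z Y - M * p|} := measureReal_mono hsub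
    _ ≤ M * p / (M * p / 2) ^ 2 := h3.trans (by gcongr)
    _ = 4 / (M * p) := by field_simp; norm_num
    _ ≤ 4 / (2 * m) := by gcongr
    _ = 2 / m := by ring

end

/-! ### The two bias bounds -/

section

variable {n N M : ℕ} {X : Fin N → E n} {D : Set (E n)} {r : ℝ} {μ : Measure (E n)} {f : E n → ℝ}

/-- The supremum in `B₁` is over a bounded set, hence an upper bound. -/
theorem specNorm_le_B₁ [IsFiniteMeasure μ] {x : E n} (hx : x ∈ chargedPts D μ r) :
    n * specNorm (expectation (localMeasure μ x r) (fun y => proj x y) -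
      (1 / (n : ℝ)) • (1 : Mat n)) ≤ B₁ D μ r := by
  rw [B₁]
  gcongr
  refine le_csSup ⟨1 + |1 / (n : ℝ)| * Real.sqrt n, ?_⟩ ⟨x, hx, rfl⟩
  rintro _ ⟨z, hz, rfl⟩
  have := isProbabilityMeasure_localMeasure z hz.2
  refine (specNorm_le_frobNorm _).trans ((frobNorm_sub_le _ _).trans ?_)
  rw [frobNorm_smul, frobNorm_one]
  gcongr
  refine (frobNorm_expectation_le (hasExpectation_proj z μ) (integrable_const (1 : ℝ))
    (Filter.Eventually.of_forall fun y => frobNorm_proj_le_one z y)).trans_eq ?_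
  simp

/-- The supremum in `B₂` is over a bounded set, hence an upper bound. -/
theorem frobNorm_le_B₂ [IsFiniteMeasure μ] (hf : IsSmooth D f) {x : E n}
    (hx : x ∈ chargedPts D μ r) :
    (n : ℝ) ^ 2 * frobNorm (expectation (localMeasure μ x r)
        (fun y => proj x y * outer (gradient f x) * proj x y) -
      ((2 / ((n : ℝ) * (n + 2))) • outer (gradient f x) +
        (‖gradient f x‖ ^ 2 / ((n : ℝ) * (n + 2))) • (1 : Mat n))) ≤ B₂ D μ f r := by
  rw [B₂]
  gcongr
  refine le_csSup ⟨gradBound D f ^ 2 + (2 / ((n : ℝ) * (n + 2)) * gradBound D f ^ 2 +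
    gradBound D f ^ 2 / ((n : ℝ) * (n + 2)) * Real.sqrt n), ?_⟩ ⟨x, hx, rfl⟩
  rintro _ ⟨z, hz, rfl⟩
  have := isProbabilityMeasure_localMeasure z hz.2
  have hg := norm_gradient_le_gradBound hf hz.1.1
  refine (frobNorm_sub_le _ _).trans (add_le_add ?_ ((frobNorm_add_le _ _).trans ?_))
  · refine (frobNorm_expectation_le (hasExpectation_proj_outer_proj z μ (gradient f z))
      (integrable_const (gradBound D f ^ 2)) (Filter.Eventually.of_forall fun y => ?_)).trans_eq ?_
    · rw [proj_mul_outer_mul_proj, frobNorm_outer]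
      have := (norm_proj_le z y (gradient f z)).trans hg
      gcongr
    · simp
  · rw [frobNorm_smul, frobNorm_smul, frobNorm_one, frobNorm_outer, abs_of_nonneg (by positivity),
      abs_of_nonneg (by positivity)]
    gcongr

theorem B₁_nonneg : 0 ≤ B₁ D μ r :=
  mul_nonneg n.cast_nonneg (Real.sSup_nonneg fun _ ⟨_, _, h⟩ => h ▸ norm_nonneg _)

theorem B₂_nonneg : 0 ≤ B₂ D μ f r :=
  mul_nonneg (sq_nonneg _) (Real.sSup_nonneg fun _ ⟨_, _, h⟩ => h ▸ frobNorm_nonneg _)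

/-- The contribution of the Taylor remainder to the bias is bounded by `remainder`. The logarithm in
`remainder` vanishes for `M = 1`; there the term `n ^ 2 * L_f ^ 2 * N ^ (-10)` takes over. -/
theorem taylor_terms_le_remainder {C₀ K : ℝ} (hn : 1 ≤ n) (hr : 0 < r) (hC : 0 < C₀) (hK : 0 < K)
    (hM : 2 ≤ M ∨ n = 1 ∧ N = 1) :
    (n : ℝ) ^ 2 * (2 * min (gradBound D f) (Real.sqrt (C₀ / (K * n)) * gradBound D f) *
      (hessBound D f * r) + (hessBound D f * r) ^ 2) ≤
      (4 * Real.sqrt C₀ + 2) * remainder D f K r N M := by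
  have hL := gradBound_nonneg D f
  have hH := hessBound_nonneg D f
  set L := gradBound D f
  set H := hessBound D f
  have hn' : (0 : ℝ) < n := by exact_mod_cast hn
  have hsC := Real.sqrt_nonneg C₀
  set R₁ : ℝ := (n : ℝ) ^ 2 * L ^ 2 * (N : ℝ) ^ (-10 : ℤ) with hR₁
  set R₂ : ℝ := r ^ 2 * H ^ 2 * (n : ℝ) ^ 2 with hR₂
  set R₃ : ℝ := r * L * H * (n : ℝ) ^ (3 / 2 : ℝ) * max (K ^ (-(1 / 2) : ℝ)) 1 *
      Real.sqrt (Real.log M) with hR₃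
  have hR : remainder D f K r N M = R₁ + R₂ + R₃ := rfl
  have h1 : 0 ≤ R₁ := by positivity
  have h2 : 0 ≤ R₂ := by positivity
  have h3 : 0 ≤ R₃ := by positivity
  rw [hR]
  rcases hM with hM | ⟨rfl, rfl⟩
  · have hlog : 1 / 2 ≤ Real.sqrt (Real.log M) := by
      refine Real.le_sqrt_of_sq_le ?_
      have : Real.log 2 ≤ Real.log M := Real.log_le_log (by norm_num) (by exact_mod_cast hM)
      linarith [Real.log_two_gt_d9]
    have hmain : (n : ℝ) ^ 2 * Real.sqrt (C₀ / (K * n)) =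
        Real.sqrt C₀ * ((n : ℝ) ^ (3 / 2 : ℝ) * K ^ (-(1 / 2) : ℝ)) := by
      rw [Real.sqrt_div' _ (by positivity), Real.sqrt_mul hK.le, Real.rpow_neg hK.le,
        ← Real.sqrt_eq_rpow, show (3 / 2 : ℝ) = 1 + 1 / 2 by norm_num, Real.rpow_add hn',
        Real.rpow_one, ← Real.sqrt_eq_rpow]
      have : Real.sqrt n * Real.sqrt n = n := Real.mul_self_sqrt hn'.le
      have hs : 0 < Real.sqrt n := Real.sqrt_pos.2 hn'
      have hk : 0 < Real.sqrt K := Real.sqrt_pos.2 hK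
      field_simp
      rw [sq, this]
    have hc : (n : ℝ) ^ 2 * (2 * min L (Real.sqrt (C₀ / (K * n)) * L) * (H * r)) ≤
        4 * Real.sqrt C₀ * R₃ := by
      calc _ ≤ (n : ℝ) ^ 2 * (2 * (Real.sqrt (C₀ / (K * n)) * L) * (H * r)) := by
            gcongr
            exact min_le_right _ _
        _ = 4 * Real.sqrt C₀ * (r * L * H * (n : ℝ) ^ (3 / 2 : ℝ) * K ^ (-(1 / 2) : ℝ) *
              (1 / 2)) := by
            linear_combination (2 * L * (H * r)) * hmain
        _ ≤ _ := by
            rw [hR₃]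
            gcongr
            exact le_max_left _ _
    nlinarith [mul_nonneg hsC h1, mul_nonneg hsC h2]
  · have h4 : min L (Real.sqrt (C₀ / (K * (1 : ℕ))) * L) * (H * r) ≤ L * (H * r) := by
      gcongr
      exact min_le_left _ _
    have h5 : R₁ = L ^ 2 := by simp [hR₁]
    have h6 : R₂ = (H * r) ^ 2 := by rw [hR₂]; push_cast; ring
    have h7 : 0 ≤ Real.sqrt C₀ * (R₁ + R₂ + R₃) := by positivity
    push_cast at h4 ⊢
    nlinarith [sq_nonneg (L - H * r)]

theorem integral_norm_proj_gradient_le {C₀ K : ℝ} {εμ : ENNReal} (hn : 1 ≤ n) (hC : 0 < C₀)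
    (hμ : LocallyNearIsotropic D μ C₀ εμ K) (hf : IsSmooth D f) (hr : 0 < r)
    (hrμ : ENNReal.ofReal r ≤ εμ) {x : E n} (hx : x ∈ interiorPts D r)
    [IsProbabilityMeasure (localMeasure μ x r)] :
    ∫ y, ‖Matrix.toEuclideanCLM (𝕜 := ℝ) (proj x y) (gradient f x)‖ ∂(localMeasure μ x r) ≤
      min (gradBound D f) (Real.sqrt (C₀ / (K * n)) * gradBound D f) := by
  have hg := norm_gradient_le_gradBound hf hx.1
  refine le_min ?_ ((integral_norm_proj_le hn hC hμ hr hrμ hx _).trans (by gcongr))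
  refine le_trans ?_ hg
  have := integral_mono_of_nonneg (μ := localMeasure μ x r)
    (Filter.Eventually.of_forall fun y => norm_nonneg _) (integrable_const ‖gradient f x‖)
    (Filter.Eventually.of_forall fun y => norm_proj_le x y (gradient f x))
  simpa using this

/-- If every ball is expected to contain at least `2 m` sample points, the bias is bounded by
`B + R`. -/
theorem bias_bound {C₀ K : ℝ} {εμ : ENNReal} {m : ℕ} [IsProbabilityMeasure μ] (hn : 1 ≤ n)
    (hN : 1 ≤ N) (hm : 1 ≤ m) (hD : IsOpen D) (hC : 0 < C₀)
    (hμ : LocallyNearIsotropic D μ C₀ εμ K) (hf : IsSmooth D f) (hr : 0 < r)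
    (hrμ : ENNReal.ofReal r ≤ εμ) (hX : ENNReal.ofReal r ≤ separationRadius D X)
    (hρ : 0 < rho μ X r) (hM : 2 * ((m : ℝ) * N / rho μ X r) ≤ M) :
    HasExpectation (sampleLaw μ X r M) (fun Y => estimator f r m X Y) ∧
    frobNorm (expectation (sampleLaw μ X r M) (fun Y => estimator f r m X Y) - empirical f X) ≤
      (12 * Real.sqrt C₀ + 6) * (B D μ f r m + remainder D f K r N M) := by
  have hm0 : (0 : ℝ) < m := by exact_mod_cast hm
  have hN0 : (0 : ℝ) < N := by exact_mod_cast hN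
  have hrho (i : Fin N) : rho μ X r ≤
      N * (μ.real (Metric.ball (X i) r) / μ.real (ballUnion X r)) := by
    rw [rho]
    gcongr
    exact ciInf_le ⟨0, by rintro _ ⟨j, rfl⟩; positivity⟩ i
  have hpos (i : Fin N) : 0 < μ.real (Metric.ball (X i) r) / μ.real (ballUnion X r) :=
    pos_of_mul_pos_right (hρ.trans_le (hrho i)) hN0.le
  have hball (i : Fin N) : μ (Metric.ball (X i) r) ≠ 0 := by
    intro h
    have := hpos i
    simp [Measure.real, h] at this
  have hunion : μ (ballUnion X r) ≠ 0 := fun h =>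
    hball ⟨0, hN⟩ (measure_mono_null (ball_subset_ballUnion _) h)
  have hν : IsProbabilityMeasure (ProbabilityTheory.cond μ (ballUnion X r)) :=
    cond_isProbabilityMeasure hunion
  have hp (i : Fin N) : (ProbabilityTheory.cond μ (ballUnion X r)).real (Metric.ball (X i) r) =
      μ.real (Metric.ball (X i) r) / μ.real (ballUnion X r) := by
    rw [Measure.real, cond_apply measurableSet_ballUnion,
      Set.inter_eq_self_of_subset_right (ball_subset_ballUnion i), ENNReal.toReal_mul,
      ENNReal.toReal_inv, Measure.real, Measure.real]
    ring
  have hMp (i : Fin N) : 2 * (m : ℝ) ≤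
      M * (ProbabilityTheory.cond μ (ballUnion X r)).real (Metric.ball (X i) r) := by
    rw [hp]
    rw [← mul_div_assoc, div_le_iff₀ hρ] at hM
    have h1 : (M : ℝ) * rho μ X r ≤
        M * (N * (μ.real (Metric.ball (X i) r) / μ.real (ballUnion X r))) := by
      gcongr
      exact hrho i
    refine le_of_mul_le_mul_left ?_ hN0
    linarith
  -- The bound on the Taylor terms needs `log M > 0`.
  have hM2 : 2 ≤ M := by
    have h1 := hMp ⟨0, hN⟩
    have h2 : (M : ℝ) * (ProbabilityTheory.cond μ (ballUnion X r)).real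
        (Metric.ball (X ⟨0, hN⟩) r) ≤ M * 1 := by
      gcongr
      exact measureReal_le_one
    have h3 : (1 : ℝ) ≤ m := by exact_mod_cast hm
    have h4 : (2 : ℝ) ≤ M := by linarith
    exact_mod_cast h4
  have : IsProbabilityMeasure (sampleLaw μ X r M) := by rw [sampleLaw]; infer_instance
  set L := gradBound D f with hL
  have hL0 : 0 ≤ L := gradBound_nonneg D f
  have hint := mem_interiorPts_of_le_separationRadius hr hX
  refine frobNorm_expectation_estimator_sub_le hN fun i => ?_
  have := isProbabilityMeasure_localMeasure (X i) (hball i)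
  have hch : X i ∈ chargedPts D μ r := ⟨hint i, hball i⟩
  have hg := norm_gradient_le_gradBound hf (hint i).1
  obtain ⟨h1, h2⟩ := frobNorm_expectation_summand_sub_le (P := sampleLaw μ X r M)
    (τ := 1 / (m : ℝ) * (3 * L ^ 2 * (1 + Real.sqrt n))) hn hm hr hD hf hX ae_exists_mem_cell
    (fun σ hσ => cond_sampleLaw_cell hσ) i hg
    (integral_norm_proj_gradient_le hn hC hμ hf hr hrμ (hint i)) (specNorm_le_B₁ hch)
    (frobNorm_le_B₂ hf hch)
    (fun σ _ hcard => by
      have : (0 : ℝ) < (labelled σ (X i)).card := by exact_mod_cast hm.trans hcard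
      gcongr
      rw [sub_le_self_iff]
      positivity) (by positivity)
  refine ⟨h1, h2.trans ?_⟩
  have h3 := taylor_terms_le_remainder (N := N) (D := D) (f := f) hn hr hC hμ.rate_pos
    (Or.inl hM2)
  have h4 := measureReal_numNeighbors_lt_le hm i (hMp i)
  have h5 := mul_le_mul_of_nonneg_left h4 (sq_nonneg L)
  have hβ₁ : 0 ≤ B₁ D μ r := B₁_nonneg
  have hβ₂ : 0 ≤ B₂ D μ f r / m := div_nonneg B₂_nonneg hm0.le
  have hsC := Real.sqrt_nonneg C₀
  have h6 : L ^ 2 * (2 / m) ≤ 2 * (1 / (m : ℝ) * (L ^ 2 * (1 + Real.sqrt n))) := by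
    calc L ^ 2 * (2 / m) = 2 * (1 / (m : ℝ) * (L ^ 2 * (1 + 0))) := by ring
      _ ≤ _ := by gcongr; exact Real.sqrt_nonneg _
  have hB : B D μ f r m = 2 * (B₂ D μ f r / m) + 4 * B₁ D μ r * (B₁ D μ r + 1) * L ^ 2 +
      2 * (1 / (m : ℝ) * (L ^ 2 * (1 + Real.sqrt n))) := by
    rw [B]
    ring
  have h7 : 0 ≤ 1 / (m : ℝ) * (L ^ 2 * (1 + Real.sqrt n)) := by positivity
  have h8 : 0 ≤ B₁ D μ r * L ^ 2 := by positivity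
  have h9 : 0 ≤ B₁ D μ r ^ 2 * L ^ 2 := by positivity
  have hB0 : 0 ≤ B D μ f r m := by rw [hB]; nlinarith
  have h10 : 3 * (B₂ D μ f r / m + (2 * B₁ D μ r + B₁ D μ r ^ 2) * L ^ 2 +
      1 / (m : ℝ) * (3 * L ^ 2 * (1 + Real.sqrt n))) +
      2 * (1 / (m : ℝ) * (L ^ 2 * (1 + Real.sqrt n))) ≤ 6 * B D μ f r m := by
    rw [hB]
    nlinarith
  have h11 : 0 ≤ Real.sqrt C₀ * B D μ f r m := mul_nonneg hsC hB0
  linarith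

theorem measurable_numNeighbors (x : E n) :
    Measurable fun Y : Fin M → E n => numNeighbors r Y x := by
  classical
  have h (Y : Fin M → E n) : numNeighbors r Y x =
      ∑ k, if Y k ∈ Metric.ball x r then 1 else 0 := by
    simp only [numNeighbors, neighbors, Finset.card_filter]
  simp only [h]
  exact Finset.measurable_sum _ fun k _ => Measurable.ite
    (Metric.isOpen_ball.measurableSet.preimage (measurable_pi_apply k))
    measurable_const measurable_const

theorem localMeasure_uniform (hD : IsOpen D) (hb : Bornology.IsBounded D) {x : E n}
    (hx : x ∈ interiorPts D r) :
    localMeasure (ProbabilityTheory.cond volume D) x r = localMeasure volume x r := by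
  rw [localMeasure, cond_cond_eq_cond_inter' hD.measurableSet Metric.isOpen_ball.measurableSet
    hb.measure_lt_top.ne, Set.inter_eq_self_of_subset_right hx.2]
  rfl

/-- For the uniform measure and exactly `m` neighbours of every point of `X`, the bias is bounded by
`R`. -/
theorem bias_bound_uniform {C₀ K : ℝ} {εμ : ENNReal} {m : ℕ} [IsProbabilityMeasure μ] (hn : 1 ≤ n)
    (hN : 1 ≤ N) (hm : 1 ≤ m) (hD : IsOpen D) (hC : 0 < C₀)
    (hμ : LocallyNearIsotropic D μ C₀ εμ K) (hf : IsSmooth D f) (hr : 0 < r)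
    (hrμ : ENNReal.ofReal r ≤ εμ) (hX : ENNReal.ofReal r ≤ separationRadius D X)
    (hM : 2 ≤ M ∨ n = 1 ∧ N = 1) (hb : Bornology.IsBounded D)
    (hunif : μ = ProbabilityTheory.cond volume D)
    (hG : sampleLaw μ X r M {Y | ∀ i, numNeighbors r Y (X i) = m} ≠ 0) :
    HasExpectation (ProbabilityTheory.cond (sampleLaw μ X r M)
        {Y | ∀ i, numNeighbors r Y (X i) = m}) (fun Y => estimator f r m X Y) ∧
    frobNorm (expectation (ProbabilityTheory.cond (sampleLaw μ X r M)
        {Y | ∀ i, numNeighbors r Y (X i) = m}) (fun Y => estimator f r m X Y) - empirical f X) ≤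
      (12 * Real.sqrt C₀ + 6) * remainder D f K r N M := by
  have hint := mem_interiorPts_of_le_separationRadius hr hX
  have hsep : ∀ i j, X i ≠ X j → 2 * r ≤ ‖X i - X j‖ := fun i j hij =>
    two_mul_le_of_le_separationRadius hr hX hij
  have hloc (i : Fin N) : localMeasure μ (X i) r = localMeasure volume (X i) r := by
    rw [hunif, localMeasure_uniform hD hb (hint i)]
  have hprob (i : Fin N) : IsProbabilityMeasure (localMeasure μ (X i) r) := by
    rw [hloc]
    exact isProbabilityMeasure_localMeasure_volume (X i) hr
  have hunion : μ (ballUnion X r) ≠ 0 := fun h => by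
    have h0 := measure_mono_null (ball_subset_ballUnion ⟨0, hN⟩) h
    have h1 := (hprob ⟨0, hN⟩).measure_univ
    rw [localMeasure, cond_eq_zero_of_meas_eq_zero h0] at h1
    simp at h1
  have hν : IsProbabilityMeasure (ProbabilityTheory.cond μ (ballUnion X r)) :=
    cond_isProbabilityMeasure hunion
  have hP : IsProbabilityMeasure (sampleLaw μ X r M) := by rw [sampleLaw]; infer_instance
  set G : Set (Fin M → E n) := {Y | ∀ i, numNeighbors r Y (X i) = m} with hGdef
  have hGm : MeasurableSet G := by
    rw [hGdef, Set.ofPred_forall]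
    exact MeasurableSet.iInter fun i => measurable_numNeighbors (X i) (measurableSet_singleton m)
  have hP' : IsProbabilityMeasure (ProbabilityTheory.cond (sampleLaw μ X r M) G) :=
    cond_isProbabilityMeasure hG
  -- A labelling of positive conditional probability labels `m` points with each point of `X`.
  have hcard : ∀ σ : Fin M → Set.range X,
      ProbabilityTheory.cond (sampleLaw μ X r M) G (cell r σ) ≠ 0 →
      (∀ i, (labelled σ (X i)).card = m) ∧ sampleLaw μ X r M (cell r σ) ≠ 0 := by
    intro σ hσ
    have hpos := inter_pos_of_cond_ne_zero hGm hσ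
    obtain ⟨Y, hYG, hYσ⟩ := nonempty_of_measure_ne_zero hpos.ne'
    refine ⟨fun i => ?_, (hpos.trans_le (measure_mono Set.inter_subset_right)).ne'⟩
    rw [← neighbors_eq_labelled hsep hYσ i]
    exact hYG i
  have hcond : ∀ σ : Fin M → Set.range X,
      ProbabilityTheory.cond (sampleLaw μ X r M) G (cell r σ) ≠ 0 →
      (∀ k, IsProbabilityMeasure (localMeasure μ (σ k : E n) r)) ∧
      ProbabilityTheory.cond (ProbabilityTheory.cond (sampleLaw μ X r M) G) (cell r σ) =
        Measure.pi fun k => localMeasure μ (σ k : E n) r := by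
    intro σ hσ
    obtain ⟨hc, h0⟩ := hcard σ hσ
    have hsub : cell r σ ⊆ G := fun Y hY i => by
      rw [numNeighbors, neighbors_eq_labelled hsep hY i, hc i]
    obtain ⟨h1, h2⟩ := cond_sampleLaw_cell h0
    refine ⟨h1, ?_⟩
    rw [cond_cond_eq_cond_inter hGm (measurableSet_cell σ),
      Set.inter_eq_self_of_subset_right hsub, h2]
  refine frobNorm_expectation_estimator_sub_le hN fun i => ?_
  have := hprob i
  have hg := norm_gradient_le_gradBound hf (hint i).1
  obtain ⟨h1, h2⟩ := frobNorm_expectation_summand_sub_le (β₁ := 0) (β₂ := 0) (τ := 0)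
    hn hm hr hD hf hX (cond_absolutelyContinuous.ae_le ae_exists_mem_cell) hcond i hg
    (integral_norm_proj_gradient_le hn hC hμ hf hr hrμ (hint i))
    (by rw [hloc, expectation_proj_uniform (X i) hn hr]; simp [specNorm])
    (by rw [hloc, expectation_proj_outer_proj_uniform (X i) hn hr]; simp [frobNorm])
    (fun σ hσ _ => by rw [(hcard σ hσ).1 i]; simp) le_rfl
  refine ⟨h1, h2.trans ?_⟩
  have h3 := taylor_terms_le_remainder (N := N) (D := D) (f := f) hn hr hC hμ.rate_pos hM
  have h4 : (ProbabilityTheory.cond (sampleLaw μ X r M) G).real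
      {Y | numNeighbors r Y (X i) < m} = 0 := by
    rw [measureReal_eq_zero_iff]
    have h0 : ProbabilityTheory.cond (sampleLaw μ X r M) G Gᶜ = 0 := ae_cond_mem hGm
    refine measure_mono_null (t := Gᶜ) (fun Y hY hYG => ?_) h0
    exact absurd (hYG i) (ne_of_lt hY)
  rw [h4]
  simp only [zero_div, mul_zero, add_zero, zero_mul, ne_eq, OfNat.ofNat_ne_zero,
    not_false_eq_true, zero_pow]
  linarith

end

end SecondMoment

open SecondMoment in
theorem theorem1 :
    ∃ c : ℝ, 0 < c ∧ ∀ C₀ : ℝ, 0 < C₀ → ∃ C : ℝ, 0 < C ∧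
      ∀ (n N M m : ℕ) (D : Set (E n)) (μ : Measure (E n)) (f : E n → ℝ) (X : Fin N → E n)
        (εμ : ENNReal) (K ε : ℝ),
        1 ≤ n → 1 ≤ N → 1 ≤ m → N ≤ M → m ≤ M →
        IsOpen D → IsProbabilityMeasure μ → μ Dᶜ = 0 →
        LocallyNearIsotropic D μ C₀ εμ K →
        IsSmooth D f →
        (∀ i, X i ∈ D) →
        0 < ε → ENNReal.ofReal ε ≤ min εμ (separationRadius D X) →
        (n : ℝ) ^ (1 / 20 : ℝ) ≤ M →
        -- the bias bound
        (0 < rho μ X ε → 2 * ((m : ℝ) * N / rho μ X ε) ≤ M → c * Real.log N ^ 2 ≤ m →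
          HasExpectation (sampleLaw μ X ε M) (fun Y => estimator f ε m X Y) ∧
          frobNorm (expectation (sampleLaw μ X ε M) (fun Y => estimator f ε m X Y) -
              empirical f X) ≤
            C * (B D μ f ε m + remainder D f K ε N M)) ∧
        -- uniform measure, all neighbor counts equal: the same with `0` in place of `B`
        (Bornology.IsBounded D → μ = cond volume D → M = N * m →
          sampleLaw μ X ε M {Y | ∀ i, numNeighbors ε Y (X i) = m} ≠ 0 →
          HasExpectation (cond (sampleLaw μ X ε M) {Y | ∀ i, numNeighbors ε Y (X i) = m})
            (fun Y => estimator f ε m X Y) ∧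
          frobNorm (expectation (cond (sampleLaw μ X ε M) {Y | ∀ i, numNeighbors ε Y (X i) = m})
              (fun Y => estimator f ε m X Y) - empirical f X) ≤
            C * remainder D f K ε N M) := by
  refine ⟨1, one_pos, fun C₀ hC => ⟨12 * Real.sqrt C₀ + 6, by positivity, ?_⟩⟩
  intro n N M m D μ f X εμ K ε hn hN hm hNM _ hD _ _ hμ hf _ hε hεX hnM
  obtain ⟨hεμ, hεX⟩ := le_min_iff.1 hεX
  refine ⟨fun hρ hM _ => bias_bound hn hN hm hD hC hμ hf hε hεμ hεX hρ hM,
    fun hb hunif _ hG => bias_bound_uniform hn hN hm hD hC hμ hf hε hεμ hεX ?_ hb hunif hG⟩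
  -- A single sample point forces `N = 1`, and `n = 1` as `n ^ (1 / 20) ≤ 1`.
  by_cases hM : 2 ≤ M
  · exact Or.inl hM
  · have hM1 : M = 1 := by omega
    refine Or.inr ⟨?_, by omega⟩
    by_contra h
    have h2 : (1 : ℝ) < n := by exact_mod_cast (show 1 < n by omega)
    have := Real.one_lt_rpow h2 (show (0 : ℝ) < 1 / 20 by norm_num)
    rw [hM1, Nat.cast_one] at hnM
    linarith
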